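/- Let $p$ be a prime, let $h\ge 1$ and $d$ be integers, and let $E\in\mathbb F_p[x,y]$ have degree at most $h$ in $x$ and at most $d$ in $y$, with $E(0,0)=0$ and $E_y(0,0)\neq 0$, where $E_y=\partial E/\partial y$. Let $f=\sum_n f_nx^n\in\mathbb F_p[[x]]$ be the unique power series with $E(x,f(x))=0$ and $f(0)=0$. Put $a=y\,E_y(xy,y)$, $b=E(xy,y)/y$, $d_x=\max(\deg_xa,\deg_xb)$ and $d_y=\max(\deg_ya,\deg_yb)$. For $0\le r<p$ let $S_r$ be the section operator $S_r\sum_{i,j}c_{i,j}x^iy^j=\sum_{i,j}c_{pi+r,pj+r}x^iy^j$, and let $\mathrm{Diag}\sum_{i,j}c_{i,j}x^iy^j=\sum_ic_{i,i}x^i$. Then: 1. $b(0,0)\ne0$ and $f=\mathrm{Diag}(a/b)$. 2. $S_r(v/b)=S_r(v\,b^{p-1})/b$ for every $v\in\mathbb F_p[x,y]$ and $0\le r<p$; in particular $S_r(a/b)=S_r(a\,b^{p-1})/b$. 3. $d_x\le h$ and $d_y\le d+h$. Let $A_r$ be the square matrix of size $(1+d_x)(1+d_y)$ whose column indexed by $(i,j)$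 consists of the coefficients of $x^ny^m$ in $S_r(x^iy^jb^{p-1})$, where $0\le i,n\le d_x$ and $0\le j,m\le d_y$; let $C$ be the column of the coefficients of $a$ and $L$ the row whose only nonzero entry is a $1$ at the index $(0,0)$. If $N\geq 0$ has the base-$p$ digits $N=(N_\ell\cdots N_0)_p$, then $f_N=L\,A_{N_\ell}\cdots A_{N_0}\,C/b(0,0)$. 4. Consider the following algorithm, with input the coefficients of $E$ and an integer $N\geq 0$: compute $a$, $b$, $d_x$, $d_y$; compute the full power $B=b^{p-1}$ by binary powering, where polynomials are multiplied by Kronecker's substitution and a Schönhage–Strassen multiplication; read $L$, the matrices $A_r$, and $C$ off $B$ and $a$; return $L\,A_{N_\ell}\cdots A_{N_0}\,(C/b(0,0))$, computed by successive matrix–vector products. This algorithm returns $f_N$ and performs $$O\bigl(h^2(d+h)^2\log N\bigr)+\tilde O\bigl(p^2h(d+h)\bigr)$$ arithmetic operations ($+,-,\times,\div$) in $\mathbb F_p$. The constants in $O$ and $\tilde O$ are absolute, $\tilde O(M)$ means $O(M\log^{\kappa}M)$ for some absolute $\kappa$, and $\log N$ is read as $\log 2$ for $N<2$. -/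

import Mathlib

open scoped BigOperators

/-! # Algebraic series, diagonals and section operators -/

/-- The exponent of the monomial `x ^ i * y ^ j`; the variable `0` is `x`, the variable `1` is `y`. -/
noncomputable def expo (i j : ℕ) : Fin 2 →₀ ℕ :=
  Finsupp.single 0 i + Finsupp.single 1 j

/-- `f` is a root of `E` with `f(0) = 0`: a power series such that `E(x, f(x)) = 0`, `f(0) = 0`. -/
def IsRootAtZero {F : Type} [Field F] (E : MvPolynomial (Fin 2) F) (f : PowerSeries F) : Prop :=
  MvPolynomial.aeval ![(PowerSeries.X : PowerSeries F), f] E = 0 ∧ PowerSeries.constantCoeff f = 0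

/-- The substitution `P(x, y) ↦ P(xy, y)`. -/
noncomputable def substXY {F : Type} [Field F] (P : MvPolynomial (Fin 2) F) :
    MvPolynomial (Fin 2) F :=
  MvPolynomial.aeval
    ![(MvPolynomial.X 0 * MvPolynomial.X 1 : MvPolynomial (Fin 2) F), MvPolynomial.X 1] P

/-- The numerator `a(x, y) = y E_y(xy, y)`. -/
noncomputable def diagNum {F : Type} [Field F] (E : MvPolynomial (Fin 2) F) :
    MvPolynomial (Fin 2) F :=
  MvPolynomial.X 1 * substXY (MvPolynomial.pderiv 1 E)

/-- The denominator `b(x, y) = E(xy, y) / y`. (The division is exact when `E(0,0) = 0`.) -/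
noncomputable def diagDen {F : Type} [Field F] (E : MvPolynomial (Fin 2) F) :
    MvPolynomial (Fin 2) F :=
  (substXY E).divMonomial (Finsupp.single 1 1)

/-- `d_x = max (deg_x a, deg_x b)`. -/
noncomputable def diagDegX {F : Type} [Field F] (E : MvPolynomial (Fin 2) F) : ℕ :=
  max ((diagNum E).degreeOf 0) ((diagDen E).degreeOf 0)

/-- `d_y = max (deg_y a, deg_y b)`. -/
noncomputable def diagDegY {F : Type} [Field F] (E : MvPolynomial (Fin 2) F) : ℕ :=
  max ((diagNum E).degreeOf 1) ((diagDen E).degreeOf 1)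

/-- The diagonal `∑ c_{i,i} x ^ i` of a bivariate series `∑ c_{i,j} x ^ i y ^ j`. -/
noncomputable def diagonal {F : Type} [Field F] (G : MvPowerSeries (Fin 2) F) : PowerSeries F :=
  PowerSeries.mk fun n => MvPowerSeries.coeff (expo n n) G

/-- The bivariate section operator `S_r` in radix `p`:
`∑ c_{i,j} x ^ i y ^ j ↦ ∑ c_{p i + r, p j + r} x ^ i y ^ j`. -/
noncomputable def bisection {F : Type} [Field F] (p r : ℕ) (G : MvPowerSeries (Fin 2) F) :
    MvPowerSeries (Fin 2) F :=
  fun n => MvPowerSeries.coeff (p • n + expo r r) G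

/-- The matrix `A_r` of the pseudo-section operator `T_r v = S_r (v b ^ (p - 1))` in the monomial
basis `x ^ i y ^ j`, `i ≤ d_x`, `j ≤ d_y`: the entry in row `(n, m)` and column `(i, j)` is the
coefficient of `x ^ n y ^ m` in `T_r (x ^ i y ^ j)`. -/
noncomputable def sectionMatrix {F : Type} [Field F] (p : ℕ) (b : MvPolynomial (Fin 2) F)
    (dx dy r : ℕ) : Matrix (Fin (dx + 1) × Fin (dy + 1)) (Fin (dx + 1) × Fin (dy + 1)) F :=
  fun row col => MvPowerSeries.coeff (expo row.1 row.2)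
    (bisection p r
      ((MvPolynomial.monomial (expo col.1 col.2) 1 * b ^ (p - 1) : MvPolynomial (Fin 2) F) :
        MvPowerSeries (Fin 2) F))

/-- The column vector `C` of the coordinates of `a` in the basis `x ^ i y ^ j`. -/
noncomputable def coordVector {F : Type} [Field F] (a : MvPolynomial (Fin 2) F) (dx dy : ℕ) :
    Fin (dx + 1) × Fin (dy + 1) → F :=
  fun s => a.coeff (expo s.1 s.2)

/-- The row vector `L`: value at `x = y = 0` of the elements of the basis `x ^ i y ^ j`. -/
def evalVector (F : Type) [Field F] (dx dy : ℕ) : Fin (dx + 1) × Fin (dy + 1) → F :=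
  fun s => if s = (0, 0) then 1 else 0

/-! # Computations with a count of the arithmetic operations -/

/-- The result of a computation, with the number of arithmetic operations that it performed. -/
structure Counted (α : Type) where
  val : α
  ops : ℕ

instance : Monad Counted where
  pure a := ⟨a, 0⟩
  bind x f := ⟨(f x.val).val, x.ops + (f x.val).ops⟩

/-- The interface through which the algorithm below accesses the base field. The algorithm is
written for an arbitrary type `K` with this interface, so that it has no other means to compute
with elements of `K`. -/
class FieldOps (K : Type) where
  zero : K
  one : K
  isZero : K → Bool
  add : K → K → Counted K
  sub : K → K → Counted K
  mul : K → K → Counted K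
  div : K → K → Counted K

/-- The prime field: every operation `+`, `-`, `×`, `÷` costs one. -/
instance zmodFieldOps (p : ℕ) [Fact p.Prime] : FieldOps (ZMod p) where
  zero := 0
  one := 1
  isZero x := decide (x = 0)
  add x y := ⟨x + y, 1⟩
  sub x y := ⟨x - y, 1⟩
  mul x y := ⟨x * y, 1⟩
  div x y := ⟨x / y, 1⟩

namespace Algo

/-- Run `f 0, …, f (n - 1)` and store the `n` results in an array, read as a function on `ℕ` with
the value `z` outside the array. The number of operations is the total over the `n` runs. -/
def tabulate {α : Type} (z : α) (n : ℕ) (f : ℕ → Counted α) : Counted (ℕ → α) :=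
  ⟨fun i => if i < n then (f i).val else z, ∑ i ∈ Finset.range n, (f i).ops⟩

variable {K : Type} [FieldOps K]

/-- The dot product of two vectors of length `n`. -/
def dot (u v : ℕ → K) : ℕ → Counted K
  | 0 => pure FieldOps.zero
  | n + 1 => do
    let s ← dot u v n
    let t ← FieldOps.mul (u n) (v n)
    FieldOps.add s t

/-- The product of a matrix of size `n` by a vector. -/
def matVec (n : ℕ) (A : ℕ → ℕ → K) (v : ℕ → K) : Counted (ℕ → K) :=
  tabulate FieldOps.zero n fun s => dot (A s) v n

/-- The table of the images `0, 1, …, n` of the integers in `K`, by successive additions of `1`. -/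
def intTable : ℕ → Counted (ℕ → K)
  | 0 => pure fun _ => FieldOps.zero
  | n + 1 => do
    let t ← intTable n
    let c ← FieldOps.add (t n) FieldOps.one
    pure fun i => if i = n + 1 then c else t i

/-! ## Fast multiplication of polynomials

Elements of `K[x] / (x ^ n + 1)` are arrays of `n` coefficients. The class of `x` is a root of
unity of order `2 n`, which allows fast Fourier transforms over this ring. This routine divides by
powers of two, hence needs an odd characteristic; the algorithm calls no multiplication of
polynomials in characteristic two. -/

/-- The product of `u` by `x ^ t` in `K[x] / (x ^ n + 1)`. -/
def mulXPow (n t : ℕ) (u : ℕ → K) : Counted (ℕ → K) :=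
  tabulate FieldOps.zero n fun i =>
    let j := (i + (2 * n - t % (2 * n))) % (2 * n)
    if j < n then pure (u j) else FieldOps.sub FieldOps.zero (u (j - n))

/-- The product of `u` by `c x ^ t` in `K[x] / (x ^ n + 1)`, for `c` in `K`. -/
def scaleShift (n t : ℕ) (c : K) (u : ℕ → K) : Counted (ℕ → K) := do
  let w ← mulXPow n t u
  tabulate FieldOps.zero n fun i => FieldOps.mul c (w i)

/-- Sum in `K[x] / (x ^ n + 1)`. -/
def addVec (n : ℕ) (u v : ℕ → K) : Counted (ℕ → K) :=
  tabulate FieldOps.zero n fun i => FieldOps.add (u i) (v i)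

/-- Difference in `K[x] / (x ^ n + 1)`. -/
def subVec (n : ℕ) (u v : ℕ → K) : Counted (ℕ → K) :=
  tabulate FieldOps.zero n fun i => FieldOps.sub (u i) (v i)

/-- Fast Fourier transform of length `2 ^ l` over `K[x] / (x ^ n + 1)` with root `ω = x ^ g`:
`A ↦ (∑ j < 2 ^ l, ω ^ (i j) A_j)_i`, for `ω ^ (2 ^ (l - 1)) = -1`. -/
def fft (n : ℕ) : ℕ → ℕ → (ℕ → ℕ → K) → Counted (ℕ → ℕ → K)
  | 0, _, A => pure A
  | l + 1, g, A => do
    let P ← fft n l (2 * g) fun j => A (2 * j)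
    let Q ← fft n l (2 * g) fun j => A (2 * j + 1)
    let T ← tabulate (fun _ => FieldOps.zero) (2 ^ l) fun j => mulXPow n (g * j) (Q j)
    tabulate (fun _ => FieldOps.zero) (2 ^ (l + 1)) fun i =>
      if i < 2 ^ l then addVec n (P i) (T i) else subVec n (P (i - 2 ^ l)) (T (i - 2 ^ l))

/-- The element `2 ^ l` of `K`, by doubling. -/
def twoPow : ℕ → Counted K
  | 0 => pure FieldOps.one
  | l + 1 => do
    let t ← twoPow l
    FieldOps.add t t

/-- The quadratic product in `K[x] / (x ^ n + 1)`. The auxiliary argument is the number of terms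
already summed in the coefficient of index `i`. -/
def naiveCoeff (n : ℕ) (u v : ℕ → K) (i : ℕ) : ℕ → Counted K
  | 0 => pure FieldOps.zero
  | j + 1 => do
    let s ← naiveCoeff n u v i j
    if j ≤ i then do
      let t ← FieldOps.mul (u j) (v (i - j))
      FieldOps.add s t
    else do
      let t ← FieldOps.mul (u j) (v (n + i - j))
      FieldOps.sub s t

/-- The product in `K[x] / (x ^ (2 ^ k) + 1)`, after Schönhage and Strassen. With `m = 2 ^ (k / 2)`
and `r = 2 ^ (k - k / 2)`, a polynomial is cut into `r` blocks of length `m`, that is, viewed as a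
polynomial in `y = x ^ m` modulo `y ^ r + 1` with coefficients in `K[x] / (x ^ (2 m) + 1)`. The
product modulo `y ^ r + 1` is computed by weighted Fourier transforms of length `r`. -/
def negMul (k : ℕ) (u v : ℕ → K) : Counted (ℕ → K) :=
  if hk : k < 3 then
    tabulate FieldOps.zero (2 ^ k) fun i => naiveCoeff (2 ^ k) u v i (2 ^ k)
  else do
    let m := 2 ^ (k / 2)
    let l := k - k / 2
    let r := 2 ^ l
    let n := 2 * m
    let g := n / r
    -- the blocks, weighted by the powers of a root `x ^ g` of `-1` of order `r`
    let U ← tabulate (fun _ => FieldOps.zero) r fun j =>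
      mulXPow n (g * j) fun i => if i < m then u (j * m + i) else FieldOps.zero
    let V ← tabulate (fun _ => FieldOps.zero) r fun j =>
      mulXPow n (g * j) fun i => if i < m then v (j * m + i) else FieldOps.zero
    let U' ← fft n l (2 * g) U
    let V' ← fft n l (2 * g) V
    let W' ← tabulate (fun _ => FieldOps.zero) r fun j => negMul (k / 2 + 1) (U' j) (V' j)
    -- inverse transform, with the inverse root of unity
    let W ← fft n l (2 * n - 2 * g) W'
    let c ← twoPow l
    let c' ← FieldOps.div FieldOps.one c
    let Z ← tabulate (fun _ => FieldOps.zero) r fun j =>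
      scaleShift n (2 * n - g * j) c' (W j)
    -- substitution `y = x ^ m`
    tabulate FieldOps.zero (2 ^ k) fun q =>
      let j := q / m
      let i := q % m
      if j = 0 then FieldOps.sub (Z 0 i) (Z (r - 1) (m + i))
      else FieldOps.add (Z j i) (Z (j - 1) (m + i))
  termination_by k
  decreasing_by omega

/-- The product of two bivariate polynomials of partial degrees at most `(X₁, Y₁)` and `(X₂, Y₂)`,
by Kronecker's substitution `x = y ^ w` with `w = Y₁ + Y₂ + 1`. -/
def biMul (X₁ Y₁ X₂ Y₂ : ℕ) (u v : ℕ → ℕ → K) : Counted (ℕ → ℕ → K) := do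
  let w := Y₁ + Y₂ + 1
  let k := Nat.clog 2 ((X₁ + X₂ + 1) * w)
  let c ← negMul k
    (fun s => if s / w ≤ X₁ ∧ s % w ≤ Y₁ then u (s / w) (s % w) else FieldOps.zero)
    (fun s => if s / w ≤ X₂ ∧ s % w ≤ Y₂ then v (s / w) (s % w) else FieldOps.zero)
  pure fun i j => if i ≤ X₁ + X₂ ∧ j ≤ Y₁ + Y₂ then c (i * w + j) else FieldOps.zero

/-- The power `b ^ n` of a bivariate polynomial of partial degrees at most `(X, Y)`, by binary
powering. -/
def biPow (X Y : ℕ) (b : ℕ → ℕ → K) (n : ℕ) : Counted (ℕ → ℕ → K) :=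
  if hn : n = 0 then
    pure fun i j => if i = 0 ∧ j = 0 then FieldOps.one else FieldOps.zero
  else if n = 1 then pure b
  else do
    let e := n / 2
    let q ← biPow X Y b (n / 2)
    let s ← biMul (e * X) (e * Y) (e * X) (e * Y) q q
    if n % 2 = 0 then pure s else biMul (2 * e * X) (2 * e * Y) X Y s b
  termination_by n
  decreasing_by omega

/-- A linear representation, with the data needed to use it: the size `n`, the row `L`, the
matrices `A_r`, the column `C` and the constant `b(0,0)`. Indices `(i, j)` of the basis
`x ^ i y ^ j` are encoded as `i * (d_y + 1) + j`. -/
structure LinRep (K : Type) where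
  size : ℕ
  row : ℕ → K
  mat : ℕ → ℕ → ℕ → K
  col : ℕ → K
  den : K

/-- Precomputation: from the coefficients `e i j`, `i ≤ h`, `j ≤ d`, of a polynomial `E`, the
polynomials `a = y E_y(xy, y)` and `b = E(xy, y) / y`, the power `B = b ^ (p - 1)`, and the linear
representation `(L, (A_r), C)`. -/
def precompute (p h d : ℕ) (e : ℕ → ℕ → K) : Counted (LinRep K) := do
  -- `a` and `b`
  let t ← intTable d
  let c ← tabulate (fun _ => FieldOps.zero) (h + 1) fun i =>
    tabulate FieldOps.zero (d + 1) fun j => FieldOps.mul (t j) (e i j)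
  let a : ℕ → ℕ → K := fun i j =>
    if i ≤ h ∧ i ≤ j ∧ j - i ≤ d then c i (j - i) else FieldOps.zero
  let b : ℕ → ℕ → K := fun i j =>
    if i ≤ h ∧ i ≤ j + 1 ∧ j + 1 - i ≤ d then e i (j + 1 - i) else FieldOps.zero
  -- `d_x` and `d_y`
  let supp := (Finset.range (h + 1) ×ˢ Finset.range (d + h + 1)).filter fun s =>
    FieldOps.isZero (a s.1 s.2) = false ∨ FieldOps.isZero (b s.1 s.2) = false
  let dx := supp.sup Prod.fst
  let dy := supp.sup Prod.snd
  let w := dy + 1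
  -- `B = b ^ (p - 1)`
  let B ← biPow dx dy b (p - 1)
  -- the coefficient of `x ^ n y ^ m` in `T_r (x ^ i y ^ j)` is the coefficient of
  -- `x ^ (p n + r - i) y ^ (p m + r - j)` in `B`
  pure
    { size := (dx + 1) * (dy + 1)
      row := fun s => if s = 0 then FieldOps.one else FieldOps.zero
      mat := fun r s s' =>
        if s' / w ≤ p * (s / w) + r ∧ s' % w ≤ p * (s % w) + r then
          B (p * (s / w) + r - s' / w) (p * (s % w) + r - s' % w)
        else FieldOps.zero
      col := fun s => a (s / w) (s % w)
      den := b 0 0 }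

/-- The product `A_{N_ℓ} ⋯ A_{N_0} v` for the list of digits `N_0, …, N_ℓ`. -/
def applyDigits (R : LinRep K) : List ℕ → (ℕ → K) → Counted (ℕ → K)
  | [], v => pure v
  | r :: rs, v => do
    let v' ← matVec R.size (R.mat r) v
    applyDigits R rs v'

/-- `L A_{N_ℓ} ⋯ A_{N_0} C / b(0,0)` for `N = (N_ℓ … N_0)_p`. -/
def evalLinRep (p : ℕ) (R : LinRep K) (N : ℕ) : Counted K := do
  let v ← tabulate FieldOps.zero R.size fun s => FieldOps.div (R.col s) R.den
  let v' ← applyDigits R (Nat.digits p N) v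
  dot R.row v' R.size

/-- The algorithm "`N`th coefficient via diagonals", for a polynomial given by its coefficients
`e i j`, `i ≤ h`, `j ≤ d`. -/
def nthCoeffViaDiagonals (p h d : ℕ) (e : ℕ → ℕ → K) (N : ℕ) : Counted K := do
  let R ← precompute p h d e
  evalLinRep p R N

end Algo

/-! Furstenberg's formula. The root `f`, obtained by Newton iteration, splits off over the power
series in x: E = (y - f)G with G polynomial in y. After x ↦ xy, with s = f(xy)/y and P, P' the
images of G and G_y, this reads b = (1 - s)P and a = y(P + y(1 - s)P'), so that a/b = y²P'/P + y +
f(xy) + f(xy)s/(1 - s). Grade x^i y^j by j - i: series in xy have degree 0, the series P, P' and 1/P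
have no negative degrees, and s lives in degrees at most -1. The terms other than f(xy) therefore
live in degrees ≥ 2, ≥ 1 and ≤ -1, and only f(xy) meets the diagonal. `SlopeGE` keeps track of this,
with w = 1 for lower bounds on j - i and w = -1 for upper bounds.

Linear representation. Write 1/b = b^(p-1)/b^p. Over the prime field b^p has the coefficients of b
at exponents multiplied by p, so it leaves a section operator as b (`bisection_mul_coe_pow`). If v
and b have degrees at most (d_x, d_y), then v b^(p-1) has degrees at most (p d_x, p d_y), and its
sections again at most (d_x, d_y). Each digit of N thus replaces v/b by another fraction with the
same denominator, its numerator in one fixed finite-dimensional space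
(`coeff_mul_inv_eq_linearRepresentation`).

Algorithm. Arrays are interpreted in algebras containing an element ξ with ξ^n = -1 (`evalAt`),
where the fast transforms become identities between powers of ξ; the product is recovered because a
polynomial of degree less than n is determined modulo x^n + 1 (`evalAt_negMul`). For the cost, one
product of length 2^k takes at most 2^k(10k³ + 8) operations, every product in the powering of b has
size at most p²h(d + h), the matrices are read off without arithmetic, and each digit of N costs one
product of a matrix of size O(h(d + h)) by a vector. -/

/-! ## Roots of polynomials over a ring of power series -/

namespace PowerSeries

variable {F : Type} [Field F]

theorem constantCoeff_eval_eq (P : Polynomial (PowerSeries F)) {g : PowerSeries F}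
    (hg : constantCoeff g = 0) : constantCoeff (P.eval g) = constantCoeff (P.eval 0) := by
  have h1 : (X : PowerSeries F) ∣ P.eval g - P.eval 0 :=
    dvd_trans (by simpa [X_dvd_iff] using hg) (Polynomial.sub_dvd_eval_sub g 0 P)
  rw [X_dvd_iff, map_sub, sub_eq_zero] at h1
  exact h1

/-- One Newton step, with the derivative frozen at the origin. -/
theorem X_pow_succ_dvd_eval_newton (Q : Polynomial (PowerSeries F))
    (h1 : constantCoeff (Q.derivative.eval 0) ≠ 0)
    (g : PowerSeries F) (hg : constantCoeff g = 0) (n : ℕ) (h : X ^ (n + 1) ∣ Q.eval g) :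
    X ^ (n + 2) ∣ Q.eval (g + -C (constantCoeff (Q.derivative.eval 0))⁻¹ * Q.eval g) := by
  set c := constantCoeff (Q.derivative.eval 0) with hc
  obtain ⟨k, hk⟩ := Polynomial.binomExpansion Q g (-C c⁻¹ * Q.eval g)
  rw [hk]
  -- The derivative at g agrees with the frozen one modulo `X`, so the linear part of the Taylor
  -- expansion gains one order; the quadratic part gains at least one as well.
  have hX : (X : PowerSeries F) ∣ 1 - C c⁻¹ * Q.derivative.eval g := by
    rw [X_dvd_iff]
    simp [constantCoeff_eval_eq _ hg, ← hc, inv_mul_cancel₀ h1]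
  have e : Q.eval g + Q.derivative.eval g * (-C c⁻¹ * Q.eval g) + k * (-C c⁻¹ * Q.eval g) ^ 2 =
      Q.eval g * (1 - C c⁻¹ * Q.derivative.eval g) + k * C c⁻¹ ^ 2 * Q.eval g ^ 2 := by ring
  rw [e]
  refine dvd_add ?_ (Dvd.dvd.mul_left ?_ _)
  · rw [pow_succ]
    exact mul_dvd_mul h hX
  · calc (X : PowerSeries F) ^ (n + 2) ∣ X ^ ((n + 1) * 2) := pow_dvd_pow _ (by omega)
      _ = (X ^ (n + 1)) ^ 2 := pow_mul _ _ _
      _ ∣ _ := pow_dvd_pow_of_dvd h 2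

/-- The Newton iterates from 0 gain one correct coefficient at each step, so they converge
coefficientwise. -/
theorem exists_root_of_derivative_ne_zero (Q : Polynomial (PowerSeries F))
    (h0 : constantCoeff (Q.eval 0) = 0) (h1 : constantCoeff (Q.derivative.eval 0) ≠ 0) :
    ∃ f : PowerSeries F, constantCoeff f = 0 ∧ Q.eval f = 0 := by
  let g : ℕ → PowerSeries F := fun n =>
    Nat.rec 0 (fun _ g => g + -C (constantCoeff (Q.derivative.eval 0))⁻¹ * Q.eval g) n
  have hs : ∀ n, g (n + 1) = g n + -C (constantCoeff (Q.derivative.eval 0))⁻¹ * Q.eval (g n) :=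
    fun n => rfl
  have hg : ∀ n, constantCoeff (g n) = 0 ∧ X ^ (n + 1) ∣ Q.eval (g n) := by
    intro n
    induction n with
    | zero => exact ⟨by simp [g], by simpa [g, X_dvd_iff] using h0⟩
    | succ n ih =>
      refine ⟨?_, hs n ▸ X_pow_succ_dvd_eval_newton Q h1 _ ih.1 n ih.2⟩
      rw [hs, map_add, map_mul, ih.1, constantCoeff_eval_eq Q ih.1, h0]
      simp
  have hst : ∀ n, X ^ (n + 1) ∣ g (n + 1) - g n := by
    intro n
    rw [hs, add_sub_cancel_left]
    exact (hg n).2.mul_left _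
  have hst2 : ∀ n k, X ^ (n + 1) ∣ g (n + k) - g n := by
    intro n k
    induction k with
    | zero => simp
    | succ k ih =>
      have := dvd_add ((pow_dvd_pow X (by omega : n + 1 ≤ n + k + 1)).trans (hst (n + k))) ih
      simpa [add_assoc] using this
  -- The coefficient of index n no longer changes after the iterate `g n`, so the diagonal of the
  -- iterates is their limit.
  let f : PowerSeries F := mk fun n => coeff n (g n)
  have hf : ∀ n, X ^ (n + 1) ∣ f - g n := by
    intro n
    rw [X_pow_dvd_iff]
    intro m hm
    have := X_pow_dvd_iff.1 (hst2 m (n - m)) m (by omega)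
    rw [show m + (n - m) = n by omega, map_sub, sub_eq_zero] at this
    simp [f, this]
  refine ⟨f, by rw [← coeff_zero_eq_constantCoeff_apply]; simp [f, g], ?_⟩
  ext n
  have h2 : X ^ (n + 1) ∣ Q.eval f := by
    have := dvd_add ((hf n).trans (Polynomial.sub_dvd_eval_sub f (g n) Q)) (hg n).2
    simpa using this
  simpa using X_pow_dvd_iff.1 h2 n (by omega)

theorem root_unique_of_derivative_ne_zero (Q : Polynomial (PowerSeries F))
    (h1 : constantCoeff (Q.derivative.eval 0) ≠ 0) {f g : PowerSeries F}
    (hf : constantCoeff f = 0) (hg : constantCoeff g = 0)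
    (hQf : Q.eval f = 0) (hQg : Q.eval g = 0) : g = f := by
  obtain ⟨k, hk⟩ := Polynomial.binomExpansion Q f (g - f)
  rw [add_sub_cancel, hQf, hQg, zero_add, pow_two, ← mul_assoc, ← add_mul] at hk
  -- Taylor's formula at `f` factors the difference of values by g - f; the cofactor has constant
  -- term Q'(0)(0) ≠ 0, hence is nonzero in a domain.
  rcases mul_eq_zero.1 hk.symm with h | h
  · have := congrArg constantCoeff h
    simp [constantCoeff_eval_eq _ hf, hf, hg] at this
    exact absurd this h1
  · exact sub_eq_zero.1 h

end PowerSeries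

/-! ## Coefficients of the numerator and of the denominator -/

@[simp] theorem expo_apply_zero (i j : ℕ) : expo i j 0 = i := by simp [expo]

@[simp] theorem expo_apply_one (i j : ℕ) : expo i j 1 = j := by simp [expo]

theorem expo_eta (n : Fin 2 →₀ ℕ) : expo (n 0) (n 1) = n := by
  ext i; fin_cases i <;> simp

theorem expo_ext {m n : Fin 2 →₀ ℕ} (h0 : m 0 = n 0) (h1 : m 1 = n 1) : m = n := by
  rw [← expo_eta m, ← expo_eta n, h0, h1]

theorem expo_le_iff {m n : Fin 2 →₀ ℕ} : m ≤ n ↔ m 0 ≤ n 0 ∧ m 1 ≤ n 1 := by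
  rw [Finsupp.le_def, Fin.forall_fin_two]

theorem expo_zero_zero : expo 0 0 = 0 := by simp [expo]

section Coefficients

variable {F : Type} [Field F]

open MvPolynomial

theorem substXY_monomial (m : Fin 2 →₀ ℕ) (c : F) :
    substXY (monomial m c) = monomial (expo (m 0) (m 0 + m 1)) c := by
  rw [substXY, aeval_monomial, Finsupp.prod_fintype _ _ (by simp), Fin.prod_univ_two]
  simp only [Matrix.cons_val_zero, Matrix.cons_val_one, X, monomial_mul, monomial_pow, one_mul,
    one_pow, algebraMap_eq, C_apply]
  congr 2
  · apply expo_ext <;> simp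
  · rw [mul_one]

theorem coeff_substXY (P : MvPolynomial (Fin 2) F) (i j : ℕ) :
    (substXY P).coeff (expo i j) = if i ≤ j then P.coeff (expo i (j - i)) else 0 := by
  induction P using MvPolynomial.induction_on' with
  | monomial m c =>
    rw [substXY_monomial, coeff_monomial, coeff_monomial]
    have h : (expo (m 0) (m 0 + m 1) = expo i j) ↔ i ≤ j ∧ m = expo i (j - i) := by
      constructor
      · intro h
        have h0 := DFunLike.congr_fun h 0
        have h1 := DFunLike.congr_fun h 1
        simp only [expo_apply_zero, expo_apply_one] at h0 h1
        exact ⟨by omega, expo_ext (by simpa using h0) (by simp; omega)⟩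
      · rintro ⟨hij, rfl⟩
        apply expo_ext <;> simp [hij]
    simp only [h]
    split_ifs <;> simp_all
  | add p q hp hq =>
    have : substXY (p + q) = substXY p + substXY q := by simp [substXY]
    rw [this, coeff_add, hp, hq, coeff_add]
    split_ifs <;> simp

theorem coeff_diagNum (E : MvPolynomial (Fin 2) F) (i j : ℕ) :
    (diagNum E).coeff (expo i j) =
      if i ≤ j then ((j - i : ℕ) : F) * E.coeff (expo i (j - i)) else 0 := by
  rw [diagNum, coeff_X_mul']
  by_cases hj : j = 0
  · subst hj
    simp [expo]
  · have hs : (1 : Fin 2) ∈ (expo i j).support := by simp [hj]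
    have he : expo i j - Finsupp.single 1 1 = expo i (j - 1) := by
      apply expo_ext <;> simp
    rw [if_pos hs, he, coeff_substXY, coeff_pderiv]
    by_cases hij : i ≤ j - 1
    · have he2 : expo i (j - 1 - i) + Finsupp.single 1 1 = expo i (j - i) := by
        apply expo_ext <;> simp; omega
      rw [if_pos hij, if_pos (by omega), he2, expo_apply_one, mul_comm]
      congr 1
      rw [← Nat.cast_add_one]
      congr 1
      omega
    -- Since j ≠ 0, the only remaining case with i ≤ j is i = j, where the factor j - i vanishes.
    · rw [if_neg hij]
      split_ifs
      · simp [show j - i = 0 by omega]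
      · rfl

theorem coeff_diagDen (E : MvPolynomial (Fin 2) F) (i j : ℕ) :
    (diagDen E).coeff (expo i j) =
      if i ≤ j + 1 then E.coeff (expo i (j + 1 - i)) else 0 := by
  rw [diagDen, coeff_divMonomial]
  have he : Finsupp.single 1 1 + expo i j = expo i (j + 1) := by
    apply expo_ext <;> simp [add_comm]
  rw [he, coeff_substXY]

/-- In E(xy, y) the exponent of y is at least that of x, so the only monomial not divisible by y is
the constant one, which E(0,0) = 0 removes. -/
theorem X_mul_diagDen {E : MvPolynomial (Fin 2) F} (h0 : constantCoeff E = 0) :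
    X 1 * diagDen E = substXY E := by
  ext m
  rw [← expo_eta m, coeff_X_mul']
  by_cases hm : m 1 = 0
  · rw [hm, if_neg (by simp), coeff_substXY]
    split_ifs with h
    · rw [Nat.le_zero.1 h, Nat.sub_zero, expo_zero_zero]
      exact h0.symm
    · rfl
  · have he : expo (m 0) (m 1) - Finsupp.single 1 1 = expo (m 0) (m 1 - 1) := by
      apply expo_ext <;> simp
    rw [if_pos (by simpa using hm), he, coeff_diagDen, coeff_substXY,
      Nat.sub_add_cancel (by omega)]

theorem constantCoeff_diagDen (E : MvPolynomial (Fin 2) F) :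
    constantCoeff (diagDen E) = constantCoeff (pderiv 1 E) := by
  rw [constantCoeff_eq, ← expo_zero_zero, coeff_diagDen, coeff_pderiv]
  have : expo 0 0 + Finsupp.single 1 1 = expo 0 1 := by apply expo_ext <;> simp
  simp [this]

theorem coeff_eq_zero_of_degreeOf_lt {σ R : Type*} [CommSemiring R] {P : MvPolynomial σ R} {i : σ}
    {m : σ →₀ ℕ} (h : P.degreeOf i < m i) : P.coeff m = 0 := by
  by_contra hc
  exact absurd (monomial_le_degreeOf i (mem_support_iff.2 hc)) (by omega)

theorem degreeOf_le_of_coeff {P : MvPolynomial (Fin 2) F} {k : Fin 2} {D : ℕ}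
    (h : ∀ i j, P.coeff (expo i j) ≠ 0 → expo i j k ≤ D) : P.degreeOf k ≤ D := by
  rw [degreeOf_eq_sup]
  refine Finset.sup_le fun m hm => ?_
  have := h (m 0) (m 1)
  rw [expo_eta] at this
  exact this (mem_support_iff.1 hm)

theorem degrees_of_coeff_ne_zero {E : MvPolynomial (Fin 2) F} {i j h d : ℕ}
    (hx : E.degreeOf 0 ≤ h) (hy : E.degreeOf 1 ≤ d) (hc : E.coeff (expo i j) ≠ 0) :
    i ≤ h ∧ j ≤ d := by
  constructor
  · by_contra hlt
    exact hc (coeff_eq_zero_of_degreeOf_lt (i := 0) (by simp; omega))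
  · by_contra hlt
    exact hc (coeff_eq_zero_of_degreeOf_lt (i := 1) (by simp; omega))

theorem degrees_of_coeff_diag_ne_zero {E : MvPolynomial (Fin 2) F} {h d : ℕ}
    (hx : E.degreeOf 0 ≤ h) (hy : E.degreeOf 1 ≤ d) (i j : ℕ)
    (hc : (diagNum E).coeff (expo i j) ≠ 0 ∨ (diagDen E).coeff (expo i j) ≠ 0) :
    i ≤ h ∧ j ≤ d + h := by
  rcases hc with hc | hc
  · rw [coeff_diagNum] at hc
    split_ifs at hc with hij
    · have := degrees_of_coeff_ne_zero hx hy (right_ne_zero_of_mul hc)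
      omega
    · exact absurd rfl hc
  · rw [coeff_diagDen] at hc
    split_ifs at hc with hij
    · have := degrees_of_coeff_ne_zero hx hy hc
      omega
    · exact absurd rfl hc

theorem diagDegX_le {E : MvPolynomial (Fin 2) F} {h d : ℕ}
    (hx : E.degreeOf 0 ≤ h) (hy : E.degreeOf 1 ≤ d) : diagDegX E ≤ h :=
  max_le
    (degreeOf_le_of_coeff fun i j hc => by
      simpa using (degrees_of_coeff_diag_ne_zero hx hy i j (Or.inl hc)).1)
    (degreeOf_le_of_coeff fun i j hc => by
      simpa using (degrees_of_coeff_diag_ne_zero hx hy i j (Or.inr hc)).1)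

theorem diagDegY_le {E : MvPolynomial (Fin 2) F} {h d : ℕ}
    (hx : E.degreeOf 0 ≤ h) (hy : E.degreeOf 1 ≤ d) : diagDegY E ≤ d + h :=
  max_le
    (degreeOf_le_of_coeff fun i j hc => by
      simpa using (degrees_of_coeff_diag_ne_zero hx hy i j (Or.inl hc)).2)
    (degreeOf_le_of_coeff fun i j hc => by
      simpa using (degrees_of_coeff_diag_ne_zero hx hy i j (Or.inr hc)).2)

end Coefficients

/-! ## Diagonals of bivariate power series -/

section Slope

variable {F : Type} [Field F]

open MvPowerSeries

/-- All monomials `x ^ i y ^ j` of `G` satisfy `c ≤ w (j - i)`. -/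
def SlopeGE (w c : ℤ) (G : MvPowerSeries (Fin 2) F) : Prop :=
  ∀ n, coeff n G ≠ 0 → c ≤ w * ((n 1 : ℤ) - n 0)

namespace SlopeGE

variable {w c c' : ℤ} {G H : MvPowerSeries (Fin 2) F}

theorem mono (h : SlopeGE w c G) (hc : c' ≤ c) : SlopeGE w c' G := fun n hn => hc.trans (h n hn)

theorem add (hG : SlopeGE w c G) (hH : SlopeGE w c H) : SlopeGE w c (G + H) := by
  intro n hn
  by_cases h : coeff n G = 0
  · exact hH n (by simpa [h] using hn)
  · exact hG n h

theorem neg (hG : SlopeGE w c G) : SlopeGE w c (-G) := fun n hn => hG n (by simpa using hn)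

theorem mul (hG : SlopeGE w c G) (hH : SlopeGE w c' H) : SlopeGE w (c + c') (G * H) := by
  intro n hn
  rw [coeff_mul] at hn
  obtain ⟨⟨k, l⟩, hkl, hne⟩ := Finset.exists_ne_zero_of_sum_ne_zero hn
  have h1 := hG k (left_ne_zero_of_mul hne)
  have h2 := hH l (right_ne_zero_of_mul hne)
  rw [Finset.HasAntidiagonal.mem_antidiagonal] at hkl
  subst hkl
  simp only [Finsupp.add_apply]
  push_cast
  linarith

theorem monomial (n : Fin 2 →₀ ℕ) (a : F) (h : c ≤ w * ((n 1 : ℤ) - n 0)) :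
    SlopeGE w c (MvPowerSeries.monomial n a) := by
  intro m hm
  rw [coeff_monomial] at hm
  split_ifs at hm with hmn
  · rwa [hmn]
  · exact absurd rfl hm

theorem one : SlopeGE w 0 (1 : MvPowerSeries (Fin 2) F) :=
  SlopeGE.monomial 0 1 (by simp)

theorem pow (hG : SlopeGE w 0 G) (k : ℕ) : SlopeGE w 0 (G ^ k) := by
  induction k with
  | zero => simpa using SlopeGE.one
  | succ k ih => simpa [pow_succ] using ih.mul hG

/-- The recursion for the coefficients of an inverse involves products of a coefficient of `G` and
an earlier one of the inverse, and the condition 0 ≤ w(j - i) is stable under addition of exponents.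
The induction is on the total degree. -/
theorem inv (hG : SlopeGE w 0 G) : SlopeGE w 0 G⁻¹ := by
  suffices ∀ (N : ℕ) (n : Fin 2 →₀ ℕ), n 0 + n 1 < N → coeff n G⁻¹ ≠ 0 →
      0 ≤ w * ((n 1 : ℤ) - n 0) from fun n hn => this _ n (Nat.lt_succ_self _) hn
  intro N
  induction N with
  | zero => intro n hn; omega
  | succ N ih =>
    intro n hn hne
    by_cases h0 : n = 0
    · simp [h0]
    · rw [coeff_inv, if_neg h0] at hne
      obtain ⟨⟨k, l⟩, hkl, hne⟩ := Finset.exists_ne_zero_of_sum_ne_zero (right_ne_zero_of_mul hne)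
      simp only [ne_eq, ite_eq_right_iff, Classical.not_imp] at hne
      obtain ⟨hlt, hne⟩ := hne
      rw [Finset.HasAntidiagonal.mem_antidiagonal] at hkl
      have hl : l 0 + l 1 < n 0 + n 1 := by
        have h1 := expo_le_iff.1 hlt.le
        by_contra hcon
        exact hlt.ne (expo_ext (by omega) (by omega))
      have h1 := hG k (left_ne_zero_of_mul hne)
      have h2 := ih l (by omega) (right_ne_zero_of_mul hne)
      subst hkl
      simp only [Finsupp.add_apply]
      push_cast
      linarith

theorem diagonal_eq_zero (hG : SlopeGE w c G) (hc : 0 < c) : diagonal G = 0 := by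
  ext n
  simp only [diagonal, PowerSeries.coeff_mk, map_zero]
  by_contra hne
  have := hG _ hne
  simp at this
  omega

end SlopeGE

theorem diagonal_add (G H : MvPowerSeries (Fin 2) F) :
    diagonal (G + H) = diagonal G + diagonal H := by
  ext n; simp [diagonal]

/-! ### The substitution x ↦ xy and Furstenberg's formula -/

theorem hasSubst_monomial_expo_one_one :
    PowerSeries.HasSubst (MvPowerSeries.monomial (expo 1 1) (1 : F)) :=
  PowerSeries.HasSubst.monomial (fun h => by simpa using DFunLike.congr_fun h 0) 1

/-- The embedding `f(x) ↦ f(xy)` of univariate series into bivariate series. -/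
noncomputable def diagEmbed : PowerSeries F →ₐ[F] MvPowerSeries (Fin 2) F :=
  PowerSeries.substAlgHom hasSubst_monomial_expo_one_one

theorem coeff_diagEmbed (f : PowerSeries F) (i j : ℕ) :
    coeff (expo i j) (diagEmbed f) = if i = j then PowerSeries.coeff i f else 0 := by
  rw [diagEmbed, PowerSeries.coe_substAlgHom,
    PowerSeries.coeff_subst hasSubst_monomial_expo_one_one, finsum_eq_single _ i]
  · rw [monomial_pow, one_pow, coeff_monomial]
    have : expo i j = i • expo 1 1 ↔ i = j := by
      constructor
      · intro h
        simpa [eq_comm] using DFunLike.congr_fun h 1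
      · rintro rfl
        apply expo_ext <;> simp
    simp only [this]
    split_ifs <;> simp
  · intro d hd
    rw [monomial_pow, coeff_monomial, if_neg, smul_zero]
    intro h
    exact hd (by simpa [eq_comm] using DFunLike.congr_fun h 0)

theorem diagEmbed_X : diagEmbed (PowerSeries.X : PowerSeries F) = X 0 * X 1 := by
  rw [diagEmbed, PowerSeries.substAlgHom_X, X, X, monomial_mul_monomial, one_mul]
  rfl

theorem slopeGE_diagEmbed (w : ℤ) (f : PowerSeries F) : SlopeGE w 0 (diagEmbed f) := by
  intro n hn
  rw [← expo_eta n, coeff_diagEmbed] at hn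
  split_ifs at hn with h
  · simp [h]
  · exact absurd rfl hn

theorem diagonal_diagEmbed (f : PowerSeries F) : diagonal (diagEmbed f) = f := by
  ext n
  simp [diagonal, coeff_diagEmbed]

theorem constantCoeff_diagEmbed (f : PowerSeries F) :
    constantCoeff (diagEmbed f) = PowerSeries.constantCoeff f := by
  rw [← coeff_zero_eq_constantCoeff_apply, ← expo_zero_zero, coeff_diagEmbed, if_pos rfl,
    PowerSeries.coeff_zero_eq_constantCoeff_apply]

/-- The part `f(xy) / y` of the geometric series. -/
theorem exists_diagEmbed_eq_X_mul {f : PowerSeries F} (hf : PowerSeries.constantCoeff f = 0) :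
    ∃ s : MvPowerSeries (Fin 2) F, diagEmbed f = X 1 * s ∧ SlopeGE (-1) 1 s := by
  have hdvd : (X 1 : MvPowerSeries (Fin 2) F) ∣ diagEmbed f := by
    rw [X_dvd_iff]
    intro m hm
    rw [← expo_eta m, coeff_diagEmbed]
    split_ifs with h
    · rw [h, hm, PowerSeries.coeff_zero_eq_constantCoeff_apply, hf]
    · rfl
  obtain ⟨s, hs⟩ := hdvd
  refine ⟨s, hs, fun n hn => ?_⟩
  have h1 : coeff (Finsupp.single 1 1 + n) (diagEmbed f) = coeff n s := by
    rw [hs, X, coeff_add_monomial_mul, one_mul]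
  rw [← h1] at hn
  have := slopeGE_diagEmbed (-1) f _ hn
  simp at this
  linarith

/-- The evaluation `P(x, y) ↦ P(xy, y)` on polynomials in `y` over the power series in `x`. -/
noncomputable def diagEval : Polynomial (PowerSeries F) →+* MvPowerSeries (Fin 2) F :=
  Polynomial.eval₂RingHom (diagEmbed : PowerSeries F →ₐ[F] _).toRingHom (X 1)

theorem slopeGE_diagEval (P : Polynomial (PowerSeries F)) : SlopeGE 1 0 (diagEval P) := by
  induction P using Polynomial.induction_on' with
  | add p q hp hq => rw [map_add]; exact hp.add hq
  | monomial k a =>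
    have : diagEval (Polynomial.monomial k a) = diagEmbed a * X 1 ^ k := by
      simp [diagEval]
    rw [this]
    have hX : SlopeGE 1 0 (X 1 : MvPowerSeries (Fin 2) F) := SlopeGE.monomial _ _ (by simp)
    simpa using (slopeGE_diagEmbed 1 a).mul (hX.pow k)

theorem constantCoeff_diagEval (P : Polynomial (PowerSeries F)) :
    constantCoeff (diagEval P) = PowerSeries.constantCoeff (P.eval 0) := by
  induction P using Polynomial.induction_on' with
  | add p q hp hq => simp only [map_add, Polynomial.eval_add, hp, hq]
  | monomial k a =>
    rcases k with _ | k <;> simp [diagEval, constantCoeff_diagEmbed]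

/-- A bivariate polynomial, viewed as a polynomial in `y` over the power series in `x`. -/
noncomputable def toPolySeries : MvPolynomial (Fin 2) F →ₐ[F] Polynomial (PowerSeries F) :=
  MvPolynomial.aeval ![Polynomial.C PowerSeries.X, Polynomial.X]

theorem eval_toPolySeries (E : MvPolynomial (Fin 2) F) (f : PowerSeries F) :
    (toPolySeries E).eval f = MvPolynomial.aeval ![(PowerSeries.X : PowerSeries F), f] E := by
  induction E using MvPolynomial.induction_on with
  | C a =>
    simp only [toPolySeries, MvPolynomial.aeval_C]
    rw [Polynomial.algebraMap_apply, Polynomial.eval_C]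
  | add p q hp hq => simp only [map_add, Polynomial.eval_add, hp, hq]
  | mul_X p i hp =>
    rw [map_mul, map_mul, Polynomial.eval_mul, hp]
    congr 1
    fin_cases i <;> simp [toPolySeries]

theorem derivative_toPolySeries (E : MvPolynomial (Fin 2) F) :
    (toPolySeries E).derivative = toPolySeries (MvPolynomial.pderiv 1 E) := by
  induction E using MvPolynomial.induction_on with
  | C a =>
    simp only [toPolySeries, MvPolynomial.aeval_C, MvPolynomial.pderiv_C, map_zero]
    rw [Polynomial.algebraMap_apply, Polynomial.derivative_C]
  | add p q hp hq => simp only [map_add, hp, hq]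
  | mul_X p i hp =>
    have hX : (toPolySeries (MvPolynomial.X i : MvPolynomial (Fin 2) F)).derivative =
        toPolySeries (MvPolynomial.pderiv 1 (MvPolynomial.X i)) := by
      fin_cases i <;> simp [toPolySeries, MvPolynomial.pderiv_X]
    rw [map_mul, Polynomial.derivative_mul, hp, hX, MvPolynomial.pderiv_mul, map_add, map_mul,
      map_mul]

theorem diagEval_toPolySeries (E : MvPolynomial (Fin 2) F) :
    diagEval (toPolySeries E) = (substXY E : MvPowerSeries (Fin 2) F) := by
  induction E using MvPolynomial.induction_on with
  | C a =>
    simp only [toPolySeries, substXY, MvPolynomial.aeval_C]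
    rw [Polynomial.algebraMap_apply]
    simp only [diagEval, Polynomial.coe_eval₂RingHom, Polynomial.eval₂_C]
    exact (diagEmbed.commutes a).trans (MvPolynomial.coe_C a).symm
  | add p q hp hq =>
    have : substXY (p + q) = substXY p + substXY q := by simp [substXY]
    rw [this, map_add, map_add, hp, hq, MvPolynomial.coe_add]
  | mul_X p i hp =>
    have : substXY (p * MvPolynomial.X i) = substXY p * substXY (MvPolynomial.X i) := by
      simp [substXY]
    rw [this, map_mul, map_mul, hp, MvPolynomial.coe_mul]
    congr 1
    fin_cases i <;> simp [toPolySeries, diagEval, substXY, diagEmbed_X]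

/-- The constant coefficient of `E(0, y)` at `y = 0`. -/
theorem constantCoeff_eval_toPolySeries (E : MvPolynomial (Fin 2) F) :
    PowerSeries.constantCoeff ((toPolySeries E).eval 0) = MvPolynomial.constantCoeff E := by
  rw [← constantCoeff_diagEval, diagEval_toPolySeries, ← coeff_zero_eq_constantCoeff_apply,
    MvPolynomial.coeff_coe, ← expo_zero_zero, coeff_substXY, if_pos le_rfl, Nat.sub_zero,
    expo_zero_zero, MvPolynomial.constantCoeff_eq]

/-- Furstenberg's formula: a root `f` of `E` with `f(0) = 0` is the diagonal of
`y E_y(xy, y) / (E(xy, y) / y)`. -/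
theorem diagonal_diagNum_mul_inv_diagDen {E : MvPolynomial (Fin 2) F}
    (hE : MvPolynomial.constantCoeff E = 0)
    (hEy : MvPolynomial.constantCoeff (MvPolynomial.pderiv 1 E) ≠ 0)
    {f : PowerSeries F} (hf : IsRootAtZero E f) :
    diagonal ((diagNum E : MvPowerSeries (Fin 2) F) *
      (diagDen E : MvPowerSeries (Fin 2) F)⁻¹) = f := by
  obtain ⟨hroot, hf0⟩ := hf
  -- The factor theorem over the ring of power series in x: E = (y - f)G.
  obtain ⟨G, hG⟩ : Polynomial.X - Polynomial.C f ∣ toPolySeries E := by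
    rw [Polynomial.dvd_iff_isRoot, Polynomial.IsRoot, eval_toPolySeries, hroot]
  obtain ⟨s, hs, hsl⟩ := exists_diagEmbed_eq_X_mul hf0
  have hXC : diagEval (Polynomial.X - Polynomial.C f) = X 1 * (1 - s) := by
    rw [mul_sub, ← hs]
    simp [diagEval]
  have hX0 : (X 1 : MvPowerSeries (Fin 2) F) ≠ 0 := fun h => by
    simpa [X] using congrArg (coeff (Finsupp.single 1 1)) h
  have hden : (diagDen E : MvPowerSeries (Fin 2) F) = (1 - s) * diagEval G := by
    apply mul_left_cancel₀ hX0
    rw [← mul_assoc, ← hXC, ← map_mul, ← hG, diagEval_toPolySeries, ← X_mul_diagDen hE,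
      MvPolynomial.coe_mul, MvPolynomial.coe_X]
  have hnum : (diagNum E : MvPowerSeries (Fin 2) F) =
      X 1 * (diagEval G + X 1 * (1 - s) * diagEval G.derivative) := by
    rw [diagNum, MvPolynomial.coe_mul, MvPolynomial.coe_X, ← diagEval_toPolySeries,
      ← derivative_toPolySeries, hG, Polynomial.derivative_mul, map_add, map_mul, map_mul, hXC]
    simp
  have hb : constantCoeff (diagDen E : MvPowerSeries (Fin 2) F) ≠ 0 := by
    rw [← coeff_zero_eq_constantCoeff_apply, MvPolynomial.coeff_coe,
      ← MvPolynomial.constantCoeff_eq, constantCoeff_diagDen]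
    exact hEy
  have hs1 : constantCoeff (1 - s) ≠ 0 := fun h => hb (by rw [hden, map_mul, h, zero_mul])
  have hG1 : constantCoeff (diagEval G) ≠ 0 := fun h => hb (by rw [hden, map_mul, h, mul_zero])
  have hsi := MvPowerSeries.mul_inv_cancel _ hs1
  have hGi := MvPowerSeries.mul_inv_cancel _ hG1
  -- The logarithmic derivative of (1 - s)P splits into y²P'/P and y/(1 - s); the latter is expanded
  -- to second order using ys = f(xy).
  have key : (diagNum E : MvPowerSeries (Fin 2) F) * (diagDen E : MvPowerSeries (Fin 2) F)⁻¹ =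
      X 1 * X 1 * (diagEval G.derivative * (diagEval G)⁻¹) +
        (X 1 + (diagEmbed f + diagEmbed f * (s * (1 - s)⁻¹))) := by
    rw [eq_comm, MvPowerSeries.eq_mul_inv_iff_mul_eq hb, hden, hnum, hs]
    set P := diagEval G
    set P' := diagEval G.derivative
    set t := (1 - s)⁻¹
    set Q := P⁻¹
    linear_combination (X 1 * X 1 * P' * (1 - s)) * hGi + X 1 * s ^ 2 * P * hsi
  have hX : SlopeGE 1 1 (X 1 : MvPowerSeries (Fin 2) F) := SlopeGE.monomial _ _ (by simp)
  have h1s : SlopeGE (-1) 0 (1 - s) := by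
    rw [sub_eq_add_neg]
    exact SlopeGE.one.add (hsl.neg.mono zero_le_one)
  -- The first summand has j - i ≥ 2, the second j - i = 1, the last j - i ≤ -1.
  rw [key, diagonal_add, diagonal_add, diagonal_add, diagonal_diagEmbed,
    SlopeGE.diagonal_eq_zero
      ((hX.mul hX).mul ((slopeGE_diagEval G.derivative).mul (slopeGE_diagEval G).inv)) (by simp),
    SlopeGE.diagonal_eq_zero hX one_pos,
    SlopeGE.diagonal_eq_zero ((slopeGE_diagEmbed (-1) f).mul (hsl.mul h1s.inv)) (by simp)]
  simp

theorem existsUnique_isRootAtZero {E : MvPolynomial (Fin 2) F}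
    (hE : MvPolynomial.constantCoeff E = 0)
    (hEy : MvPolynomial.constantCoeff (MvPolynomial.pderiv 1 E) ≠ 0) :
    ∃ f : PowerSeries F, IsRootAtZero E f ∧ ∀ g, IsRootAtZero E g → g = f := by
  have h1 : PowerSeries.constantCoeff ((toPolySeries E).derivative.eval 0) ≠ 0 := by
    rwa [derivative_toPolySeries, constantCoeff_eval_toPolySeries]
  obtain ⟨f, hf0, hf⟩ := PowerSeries.exists_root_of_derivative_ne_zero (toPolySeries E)
    (by rw [constantCoeff_eval_toPolySeries, hE]) h1
  refine ⟨f, ⟨by rw [← eval_toPolySeries, hf], hf0⟩, fun g hg => ?_⟩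
  exact PowerSeries.root_unique_of_derivative_ne_zero _ h1 hf0 hg.2 hf
    (by rw [eval_toPolySeries, hg.1])

end Slope

/-! ## Section operators and the linear representation -/

section Sections

open MvPowerSeries

theorem coeff_bisection {F : Type} [Field F] (p r : ℕ) (G : MvPowerSeries (Fin 2) F)
    (n : Fin 2 →₀ ℕ) : coeff n (bisection p r G) = coeff (p • n + expo r r) G := rfl

theorem bisection_add {F : Type} [Field F] (p r : ℕ) (G H : MvPowerSeries (Fin 2) F) :
    bisection p r (G + H) = bisection p r G + bisection p r H := by
  ext n; simp [coeff_bisection]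

variable {p : ℕ} [Fact p.Prime]

/-- A `p`-th power can be taken out of a section operator. -/
theorem bisection_mul_coe_pow {r : ℕ} (hr : r < p) (G : MvPowerSeries (Fin 2) (ZMod p))
    (b : MvPolynomial (Fin 2) (ZMod p)) :
    bisection p r (G * ((b ^ p : MvPolynomial (Fin 2) (ZMod p)) : MvPowerSeries _ _)) =
      bisection p r G * (b : MvPowerSeries (Fin 2) (ZMod p)) := by
  induction b using MvPolynomial.induction_on' with
  | monomial m c =>
    -- Here c^p = c by Fermat: this is where the base field must be the prime field.
    rw [MvPolynomial.monomial_pow, ZMod.pow_card, MvPolynomial.coe_monomial,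
      MvPolynomial.coe_monomial]
    ext n
    rw [coeff_bisection, coeff_mul_monomial, coeff_mul_monomial, coeff_bisection]
    have hp := (Fact.out : p.Prime).pos
    -- As r < p, the offset r never reaches the next multiple of p; hence the p-th power of a
    -- monomial divides x^(pn+r) exactly when the monomial divides x^n.
    have hiff : ∀ a b : ℕ, p * a ≤ p * b + r ↔ a ≤ b := by
      intro a b
      constructor
      · intro h
        by_contra hlt
        have : p * (b + 1) ≤ p * a := Nat.mul_le_mul_left p (by omega)
        rw [mul_add] at this
        omega
      · intro h
        exact (Nat.mul_le_mul_left p h).trans (Nat.le_add_right _ _)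
    have h1 : p • m ≤ p • n + expo r r ↔ m ≤ n := by
      simp [expo_le_iff, hiff]
    simp only [h1]
    split_ifs with h
    · congr 2
      obtain ⟨k, rfl⟩ := le_iff_exists_add.1 h
      rw [add_tsub_cancel_left, smul_add, add_assoc, add_tsub_cancel_left]
    · rfl
  | add f g hf hg =>
    rw [add_pow_char, MvPolynomial.coe_add, MvPolynomial.coe_add, mul_add, bisection_add, hf, hg,
      mul_add]

theorem constantCoeff_coe {F : Type} [Field F] (b : MvPolynomial (Fin 2) F) :
    constantCoeff (b : MvPowerSeries (Fin 2) F) = MvPolynomial.constantCoeff b := by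
  rw [← coeff_zero_eq_constantCoeff_apply, MvPolynomial.coeff_coe, MvPolynomial.constantCoeff_eq]

/-- Multiplied by b, the left side absorbs b^p inside the section, and (v/b) b^p = v b^(p-1). -/
theorem bisection_mul_inv {r : ℕ} (hr : r < p) (v b : MvPolynomial (Fin 2) (ZMod p))
    (hb : MvPolynomial.constantCoeff b ≠ 0) :
    bisection p r ((v : MvPowerSeries (Fin 2) (ZMod p)) * (b : MvPowerSeries (Fin 2) (ZMod p))⁻¹) =
      bisection p r ((v * b ^ (p - 1) : MvPolynomial (Fin 2) (ZMod p)) :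
        MvPowerSeries (Fin 2) (ZMod p)) * (b : MvPowerSeries (Fin 2) (ZMod p))⁻¹ := by
  have hb' : constantCoeff (b : MvPowerSeries (Fin 2) (ZMod p)) ≠ 0 := by rwa [constantCoeff_coe]
  rw [MvPowerSeries.eq_mul_inv_iff_mul_eq hb', ← bisection_mul_coe_pow hr]
  congr 1
  have hp := (Fact.out : p.Prime).pos
  have hi := MvPowerSeries.inv_mul_cancel _ hb'
  rw [MvPolynomial.coe_mul, show b ^ p = b * b ^ (p - 1) by rw [mul_pow_sub_one hp.ne'],
    MvPolynomial.coe_mul]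
  linear_combination
    (v : MvPowerSeries (Fin 2) (ZMod p)) * ((b ^ (p - 1) : MvPolynomial _ _) :) * hi

/-! The pseudo-section operator on polynomials. -/

/-- The polynomial `S_r v`, truncated to the partial degrees `(dx, dy)`. -/
noncomputable def polySection {F : Type} [Field F] (p dx dy r : ℕ)
    (v : MvPolynomial (Fin 2) F) : MvPolynomial (Fin 2) F :=
  ∑ s : Fin (dx + 1) × Fin (dy + 1),
    MvPolynomial.monomial (expo s.1 s.2) (v.coeff (p • expo s.1 s.2 + expo r r))

/-- The polynomials of partial degrees at most `(dx, dy)`. -/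
def BiDegreeLE {F : Type} [Field F] (dx dy : ℕ) (v : MvPolynomial (Fin 2) F) : Prop :=
  ∀ i j, v.coeff (expo i j) ≠ 0 → i ≤ dx ∧ j ≤ dy

section BiDegree

variable {F : Type} [Field F] {dx dy dx' dy' : ℕ}

theorem biDegreeLE_of_degreeOf_le {v : MvPolynomial (Fin 2) F} (hx : v.degreeOf 0 ≤ dx)
    (hy : v.degreeOf 1 ≤ dy) : BiDegreeLE dx dy v := fun _ _ hc =>
  degrees_of_coeff_ne_zero hx hy hc

theorem biDegreeLE_diagNum (E : MvPolynomial (Fin 2) F) :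
    BiDegreeLE (diagDegX E) (diagDegY E) (diagNum E) :=
  biDegreeLE_of_degreeOf_le (le_max_left _ _) (le_max_left _ _)

theorem biDegreeLE_diagDen (E : MvPolynomial (Fin 2) F) :
    BiDegreeLE (diagDegX E) (diagDegY E) (diagDen E) :=
  biDegreeLE_of_degreeOf_le (le_max_right _ _) (le_max_right _ _)

theorem BiDegreeLE.mul {u v : MvPolynomial (Fin 2) F} (hu : BiDegreeLE dx dy u)
    (hv : BiDegreeLE dx' dy' v) : BiDegreeLE (dx + dx') (dy + dy') (u * v) := by
  intro i j hc
  rw [MvPolynomial.coeff_mul] at hc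
  obtain ⟨⟨k, l⟩, hkl, hne⟩ := Finset.exists_ne_zero_of_sum_ne_zero hc
  rw [Finset.HasAntidiagonal.mem_antidiagonal] at hkl
  have h1 := hu (k 0) (k 1) (by rw [expo_eta]; exact left_ne_zero_of_mul hne)
  have h2 := hv (l 0) (l 1) (by rw [expo_eta]; exact right_ne_zero_of_mul hne)
  have e0 := DFunLike.congr_fun hkl 0
  have e1 := DFunLike.congr_fun hkl 1
  simp only [Finsupp.add_apply, expo_apply_zero, expo_apply_one] at e0 e1
  omega

theorem BiDegreeLE.pow {u : MvPolynomial (Fin 2) F} (hu : BiDegreeLE dx dy u) (n : ℕ) :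
    BiDegreeLE (n * dx) (n * dy) (u ^ n) := by
  induction n with
  | zero =>
    intro i j hc
    rw [pow_zero, MvPolynomial.coeff_one] at hc
    split_ifs at hc with h
    · have e0 := DFunLike.congr_fun h 0
      have e1 := DFunLike.congr_fun h 1
      simp at e0 e1
      omega
    · exact absurd rfl hc
  | succ n ih =>
    rw [pow_succ, Nat.succ_mul, Nat.succ_mul]
    exact ih.mul hu

theorem BiDegreeLE.eq_sum {v : MvPolynomial (Fin 2) F} (hv : BiDegreeLE dx dy v) :
    v = ∑ s : Fin (dx + 1) × Fin (dy + 1),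
      MvPolynomial.monomial (expo s.1 s.2) (v.coeff (expo s.1 s.2)) := by
  ext m
  rw [← expo_eta m, MvPolynomial.coeff_sum]
  simp only [MvPolynomial.coeff_monomial]
  by_cases hm : m 0 ≤ dx ∧ m 1 ≤ dy
  · rw [Finset.sum_eq_single (⟨m 0, by omega⟩, ⟨m 1, by omega⟩)]
    · simp
    · rintro ⟨⟨i, hi⟩, ⟨j, hj⟩⟩ - hne
      rw [if_neg]
      intro h
      apply hne
      have e0 := DFunLike.congr_fun h 0
      have e1 := DFunLike.congr_fun h 1
      simp only [expo_apply_zero, expo_apply_one] at e0 e1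
      simp [e0, e1]
    · simp
  · rw [Finset.sum_eq_zero]
    · by_contra hne
      exact hm (hv _ _ hne)
    · rintro ⟨⟨i, hi⟩, ⟨j, hj⟩⟩ -
      rw [if_neg]
      intro h
      apply hm
      have e0 := DFunLike.congr_fun h 0
      have e1 := DFunLike.congr_fun h 1
      simp only [expo_apply_zero, expo_apply_one] at e0 e1
      omega

end BiDegree

theorem coeff_polySection {F : Type} [Field F] (p dx dy r : ℕ) (v : MvPolynomial (Fin 2) F)
    (i j : ℕ) : (polySection p dx dy r v).coeff (expo i j) =
      if i ≤ dx ∧ j ≤ dy then v.coeff (p • expo i j + expo r r) else 0 := by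
  rw [polySection, MvPolynomial.coeff_sum]
  simp only [MvPolynomial.coeff_monomial]
  split_ifs with hm
  · rw [Finset.sum_eq_single (⟨i, by omega⟩, ⟨j, by omega⟩)]
    · simp
    · rintro ⟨⟨i', hi⟩, ⟨j', hj⟩⟩ - hne
      rw [if_neg]
      intro h
      apply hne
      have e0 := DFunLike.congr_fun h 0
      have e1 := DFunLike.congr_fun h 1
      simp only [expo_apply_zero, expo_apply_one] at e0 e1
      simp [e0, e1]
    · simp
  · rw [Finset.sum_eq_zero]
    rintro ⟨⟨i', hi⟩, ⟨j', hj⟩⟩ -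
    rw [if_neg]
    intro h
    apply hm
    have e0 := DFunLike.congr_fun h 0
    have e1 := DFunLike.congr_fun h 1
    simp only [expo_apply_zero, expo_apply_one] at e0 e1
    omega

theorem biDegreeLE_polySection {F : Type} [Field F] (p dx dy r : ℕ)
    (v : MvPolynomial (Fin 2) F) : BiDegreeLE dx dy (polySection p dx dy r v) := by
  intro i j hc
  rw [coeff_polySection] at hc
  split_ifs at hc with h
  · exact h
  · exact absurd rfl hc

/-- The truncation loses nothing: v b^(p-1) has x-degree at most d_x + (p - 1)d_x = p d_x, so a
nonzero coefficient at pn + r forces n ≤ d_x, and likewise in y. This stability gives a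
representation of finite size. -/
theorem coe_polySection {dx dy r : ℕ} {v b : MvPolynomial (Fin 2) (ZMod p)}
    (hv : BiDegreeLE dx dy v) (hb : BiDegreeLE dx dy b) :
    bisection p r ((v * b ^ (p - 1) : MvPolynomial (Fin 2) (ZMod p)) : MvPowerSeries _ _) =
      (polySection p dx dy r (v * b ^ (p - 1)) : MvPowerSeries (Fin 2) (ZMod p)) := by
  ext n
  rw [coeff_bisection, MvPolynomial.coeff_coe, MvPolynomial.coeff_coe, ← expo_eta n,
    coeff_polySection]
  split_ifs with h
  · rfl
  · by_contra hne
    have hp := (Fact.out : p.Prime).pos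
    have h1 := (hv.mul (hb.pow (p - 1))) (p * n 0 + r) (p * n 1 + r)
      (by convert hne using 2; apply expo_ext <;> simp)
    have h2 : ∀ a : ℕ, a + (p - 1) * a = p * a := by
      intro a
      rw [add_comm, ← Nat.succ_mul, Nat.succ_eq_add_one, Nat.sub_add_cancel hp]
    rw [h2, h2] at h1
    exact h ⟨Nat.le_of_mul_le_mul_left (by omega : p * n 0 ≤ p * dx) hp,
      Nat.le_of_mul_le_mul_left (by omega : p * n 1 ≤ p * dy) hp⟩

/-- Linearity in v. Nothing is asked of the degrees of `b`, since matrix and `polySection` are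
truncated at the same rows. -/
theorem sectionMatrix_mulVec_coordVector {F : Type} [Field F] (p : ℕ) {dx dy : ℕ} (r : ℕ)
    {v : MvPolynomial (Fin 2) F} (b : MvPolynomial (Fin 2) F) (hv : BiDegreeLE dx dy v) :
    (sectionMatrix p b dx dy r).mulVec (coordVector v dx dy) =
      coordVector (polySection p dx dy r (v * b ^ (p - 1))) dx dy := by
  funext s
  have hs1 := s.1.2
  have hs2 := s.2.2
  rw [coordVector, coeff_polySection, if_pos ⟨by omega, by omega⟩]
  conv_rhs => rw [hv.eq_sum, Finset.sum_mul, MvPolynomial.coeff_sum]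
  refine Finset.sum_congr rfl fun t _ => ?_
  change sectionMatrix p b dx dy r s t * coordVector v dx dy t = _
  simp only [sectionMatrix, coordVector]
  rw [coeff_bisection, MvPolynomial.coeff_coe,
    show MvPolynomial.monomial (expo t.1 t.2) (v.coeff (expo t.1 t.2)) =
      MvPolynomial.C (v.coeff (expo t.1 t.2)) * MvPolynomial.monomial (expo t.1 t.2) 1 by
      rw [MvPolynomial.C_mul_monomial, mul_one],
    mul_assoc, MvPolynomial.coeff_C_mul, mul_comm]

theorem evalVector_dotProduct {F : Type} [Field F] (dx dy : ℕ) (v : MvPolynomial (Fin 2) F) :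
    evalVector F dx dy ⬝ᵥ coordVector v dx dy = MvPolynomial.constantCoeff v := by
  simp [evalVector, dotProduct, coordVector, expo_zero_zero, MvPolynomial.constantCoeff_eq]

/-- The coefficient of `(xy) ^ N` in `v / b` through the linear representation. -/
theorem coeff_mul_inv_eq_linearRepresentation {dx dy : ℕ} {b : MvPolynomial (Fin 2) (ZMod p)}
    (hb : BiDegreeLE dx dy b) (hb0 : MvPolynomial.constantCoeff b ≠ 0) (N : ℕ)
    (v : MvPolynomial (Fin 2) (ZMod p)) (hv : BiDegreeLE dx dy v) :
    coeff (expo N N) ((v : MvPowerSeries (Fin 2) (ZMod p)) *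
        (b : MvPowerSeries (Fin 2) (ZMod p))⁻¹) =
      evalVector (ZMod p) dx dy ⬝ᵥ
        (((Nat.digits p N).reverse.map (sectionMatrix p b dx dy)).prod.mulVec
          (coordVector v dx dy)) / MvPolynomial.constantCoeff b := by
  have hp := (Fact.out : p.Prime)
  induction N using Nat.strong_induction_on generalizing v with
  | _ N ih =>
    rcases Nat.eq_zero_or_pos N with rfl | hN
    -- Zero has no digits, so the product is the identity and the value is v(0,0)/b(0,0).
    · rw [Nat.digits_zero, List.reverse_nil, List.map_nil, List.prod_nil, Matrix.one_mulVec,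
        evalVector_dotProduct, expo_zero_zero, coeff_zero_eq_constantCoeff_apply, map_mul,
        constantCoeff_inv, constantCoeff_coe, constantCoeff_coe, div_eq_mul_inv]
    · have hlt := Nat.mod_lt N hp.pos
      have hN' : expo N N = p • expo (N / p) (N / p) + expo (N % p) (N % p) := by
        have := Nat.div_add_mod N p
        apply expo_ext <;> simp [this]
      -- The section at the lowest digit reduces N to N / p and changes the numerator only. The
      -- lowest digit acts first, so its matrix stands rightmost, whence the reversed list.
      rw [hN', ← coeff_bisection, bisection_mul_inv hlt v b hb0, coe_polySection hv hb,
        ih (N / p) (Nat.div_lt_self hN hp.one_lt) _ (biDegreeLE_polySection _ _ _ _ _),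
        Nat.digits_def' hp.one_lt hN, List.reverse_cons, List.map_append, List.prod_append,
        List.map_singleton, List.prod_singleton, ← Matrix.mulVec_mulVec,
        sectionMatrix_mulVec_coordVector p _ b hv]

end Sections

/-! ## Values of the counted computations -/

namespace Counted

@[simp] theorem bind_val {α β : Type} (x : Counted α) (f : α → Counted β) :
    (x >>= f).val = (f x.val).val := rfl

@[simp] theorem bind_ops {α β : Type} (x : Counted α) (f : α → Counted β) :
    (x >>= f).ops = x.ops + (f x.val).ops := rfl

@[simp] theorem pure_val {α : Type} (a : α) : (pure a : Counted α).val = a := rfl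

@[simp] theorem pure_ops {α : Type} (a : α) : (pure a : Counted α).ops = 0 := rfl

end Counted

namespace FieldOps

variable {p : ℕ} [Fact p.Prime] (x y : ZMod p)

@[simp] theorem zero_zmod : (FieldOps.zero : ZMod p) = 0 := rfl
@[simp] theorem one_zmod : (FieldOps.one : ZMod p) = 1 := rfl
@[simp] theorem add_val : (FieldOps.add x y).val = x + y := rfl
@[simp] theorem sub_val : (FieldOps.sub x y).val = x - y := rfl
@[simp] theorem mul_val : (FieldOps.mul x y).val = x * y := rfl
@[simp] theorem div_val : (FieldOps.div x y).val = x / y := rfl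
@[simp] theorem add_ops : (FieldOps.add x y).ops = 1 := rfl
@[simp] theorem sub_ops : (FieldOps.sub x y).ops = 1 := rfl
@[simp] theorem mul_ops : (FieldOps.mul x y).ops = 1 := rfl
@[simp] theorem div_ops : (FieldOps.div x y).ops = 1 := rfl

theorem isZero_eq_false_iff : FieldOps.isZero x = false ↔ x ≠ 0 := decide_eq_false_iff_not

end FieldOps

theorem Finset.sum_range_mul_eq {M : Type*} [AddCommMonoid M] (f : ℕ → M) (r m : ℕ) :
    ∑ q ∈ range (r * m), f q = ∑ j ∈ range r, ∑ i ∈ range m, f (j * m + i) := by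
  induction r with
  | zero => simp
  | succ r ih => rw [Nat.succ_mul, Finset.sum_range_add, ih, Finset.sum_range_succ]

namespace Algo

theorem tabulate_val_of_lt {α : Type} (z : α) {n : ℕ} (f : ℕ → Counted α) {i : ℕ} (h : i < n) :
    (tabulate z n f).val i = (f i).val := if_pos h

theorem tabulate_ops {α : Type} (z : α) (n : ℕ) (f : ℕ → Counted α) :
    (tabulate z n f).ops = ∑ i ∈ Finset.range n, (f i).ops := rfl

open Finset

variable {p : ℕ} [Fact p.Prime]

/-! ### Arrays as elements of an algebra with ξ^n = -1 -/

section Evaluation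

variable {R : Type} [CommRing R] [Algebra (ZMod p) R] {ξ : R} {n : ℕ}

/-- The element of an algebra represented by the coefficients `u 0, …, u (n - 1)` in the powers
of `ξ`. -/
def evalAt (ξ : R) (n : ℕ) (u : ℕ → ZMod p) : R := ∑ i ∈ range n, u i • ξ ^ i

theorem map_evalAt {S : Type} [CommRing S] [Algebra (ZMod p) S] (φ : R →ₐ[ZMod p] S) (ξ : R)
    (n : ℕ) (u : ℕ → ZMod p) : φ (evalAt ξ n u) = evalAt (φ ξ) n u := by
  simp [evalAt, map_sum, map_smul]

theorem evalAt_addVec (u v : ℕ → ZMod p) :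
    evalAt ξ n (addVec n u v).val = evalAt ξ n u + evalAt ξ n v := by
  rw [evalAt, evalAt, evalAt, ← sum_add_distrib]
  refine sum_congr rfl fun i hi => ?_
  rw [addVec, tabulate_val_of_lt _ _ (mem_range.1 hi), FieldOps.add_val, add_smul]

theorem evalAt_subVec (u v : ℕ → ZMod p) :
    evalAt ξ n (subVec n u v).val = evalAt ξ n u - evalAt ξ n v := by
  rw [evalAt, evalAt, evalAt, ← sum_sub_distrib]
  refine sum_congr rfl fun i hi => ?_
  rw [subVec, tabulate_val_of_lt _ _ (mem_range.1 hi), FieldOps.sub_val, sub_smul]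

/-- The extension of `u 0, …, u (n - 1)` to all indices with `u (i + n) = - u i`. -/
def negExtend (n : ℕ) (u : ℕ → ZMod p) (j : ℕ) : ZMod p :=
  if j % (2 * n) < n then u (j % (2 * n)) else -u (j % (2 * n) - n)

theorem negExtend_add (hn : 0 < n) (u : ℕ → ZMod p) (j : ℕ) :
    negExtend n u (j + n) = -negExtend n u j := by
  have hlt := Nat.mod_lt j (by omega : 0 < 2 * n)
  have h : (j + n) % (2 * n) = if j % (2 * n) < n then j % (2 * n) + n else j % (2 * n) - n := by
    rw [Nat.add_mod, Nat.mod_eq_of_lt (by omega : n < 2 * n)]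
    split_ifs with h
    · exact Nat.mod_eq_of_lt (by omega)
    · rw [Nat.mod_eq_sub_mod (by omega), Nat.mod_eq_of_lt (by omega)]
      omega
  rw [negExtend, negExtend, h]
  split_ifs with h1 h2 h2
  · omega
  · simp
  · simp
  · omega

/-- Both `negExtend n u` and the powers of ξ change sign under a shift by n, so their product is
n-periodic and all windows of length n have the same sum. -/
theorem sum_negExtend_window (hn : 0 < n) (hξ : ξ ^ n = -1) (u : ℕ → ZMod p) (s : ℕ) :
    ∑ i ∈ range n, negExtend n u (i + s) • ξ ^ (i + s) = evalAt ξ n u := by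
  induction s with
  | zero =>
    refine sum_congr rfl fun i hi => ?_
    have hi := mem_range.1 hi
    rw [add_zero, negExtend, Nat.mod_eq_of_lt (by omega), if_pos hi]
  | succ s ih =>
    rw [← ih]
    -- The sum of n + 1 consecutive terms, split off at either end: the extreme terms are equal.
    have h1 := sum_range_succ (fun i => negExtend n u (i + s) • ξ ^ (i + s)) n
    have h2 := sum_range_succ' (fun i => negExtend n u (i + s) • ξ ^ (i + s)) n
    rw [h1, zero_add, add_comm n s, negExtend_add hn, pow_add, hξ, mul_neg_one, smul_neg, neg_smul,
      neg_neg, add_right_cancel_iff] at h2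
    rw [h2]
    refine sum_congr rfl fun i _ => ?_
    rw [add_right_comm, add_assoc]

theorem sum_negExtend_shift (hn : 0 < n) (hξ : ξ ^ n = -1) (u : ℕ → ZMod p) {s t : ℕ}
    (hst : ξ ^ (s + t) = 1) :
    ∑ i ∈ range n, negExtend n u (i + s) • ξ ^ i = ξ ^ t * evalAt ξ n u := by
  rw [← sum_negExtend_window hn hξ u s, mul_sum]
  refine sum_congr rfl fun i _ => ?_
  rw [mul_smul_comm, ← pow_add, show t + (i + s) = i + (s + t) by ring, pow_add, hst, mul_one]

theorem pow_two_mul_eq_one (hξ : ξ ^ n = -1) : ξ ^ (2 * n) = 1 := by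
  rw [mul_comm, pow_mul, hξ, neg_one_sq]

theorem pow_mod_two_mul (hξ : ξ ^ n = -1) (t : ℕ) : ξ ^ (t % (2 * n)) = ξ ^ t := by
  conv_rhs => rw [← Nat.div_add_mod t (2 * n), pow_add, pow_mul, pow_two_mul_eq_one hξ, one_pow,
    one_mul]

/-- The index read by `mulXPow` is i - t modulo 2n, written with 2n - t % (2n) to stay in the
natural numbers; the result is a shifted window of `negExtend`. -/
theorem evalAt_mulXPow (hn : 0 < n) (hξ : ξ ^ n = -1) (t : ℕ) (u : ℕ → ZMod p) :
    evalAt ξ n (mulXPow n t u).val = ξ ^ t * evalAt ξ n u := by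
  have hlt := Nat.mod_lt t (by omega : 0 < 2 * n)
  rw [← pow_mod_two_mul hξ t, ← sum_negExtend_shift hn hξ u (s := 2 * n - t % (2 * n))
    (by rw [Nat.sub_add_cancel hlt.le, pow_two_mul_eq_one hξ])]
  refine sum_congr rfl fun i hi => ?_
  rw [mulXPow, tabulate_val_of_lt _ _ (mem_range.1 hi), negExtend]
  split_ifs with h <;> simp [h]

theorem evalAt_scaleShift (hn : 0 < n) (hξ : ξ ^ n = -1) (t : ℕ) (c : ZMod p) (u : ℕ → ZMod p) :
    evalAt ξ n (scaleShift n t c u).val = c • (ξ ^ t * evalAt ξ n u) := by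
  rw [← evalAt_mulXPow hn hξ, evalAt, evalAt, smul_sum]
  refine sum_congr rfl fun i hi => ?_
  rw [scaleShift, Counted.bind_val, tabulate_val_of_lt _ _ (mem_range.1 hi), FieldOps.mul_val,
    mul_smul]

/-- The two branches of the routine are the two branches of `negExtend` at the index i - a modulo
2n. The sum over i then gives multiplication by ξ^a, as for a shift. -/
theorem naiveCoeff_val (u v : ℕ → ZMod p) {i : ℕ} (hi : i < n) (j : ℕ) (hj : j ≤ n) :
    (naiveCoeff n u v i j).val =
      ∑ a ∈ range j, u a * negExtend n v (i + (2 * n - a)) := by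
  induction j with
  | zero => simp [naiveCoeff]
  | succ j ih =>
    rw [sum_range_succ, ← ih (by omega), naiveCoeff, Counted.bind_val]
    split_ifs with hji
    · have : (i + (2 * n - j)) % (2 * n) = i - j := by
        rw [show i + (2 * n - j) = i - j + 2 * n by omega, Nat.add_mod_right,
          Nat.mod_eq_of_lt (by omega)]
      rw [negExtend, this, if_pos (by omega)]
      simp
    · have : (i + (2 * n - j)) % (2 * n) = n + (n + i - j) := by
        rw [Nat.mod_eq_of_lt (by omega)]; omega
      rw [negExtend, this, if_neg (by omega), Nat.add_sub_cancel_left]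
      simp [sub_eq_add_neg]

theorem evalAt_naive (hn : 0 < n) (hξ : ξ ^ n = -1) (u v : ℕ → ZMod p) :
    evalAt ξ n (tabulate FieldOps.zero n fun i => naiveCoeff n u v i n).val =
      evalAt ξ n u * evalAt ξ n v := by
  have h1 : ∀ i ∈ range n,
      (tabulate (FieldOps.zero : ZMod p) n fun i => naiveCoeff n u v i n).val i • ξ ^ i =
        ∑ a ∈ range n, u a • (negExtend n v (i + (2 * n - a)) • ξ ^ i) := by
    intro i hi
    rw [tabulate_val_of_lt _ _ (mem_range.1 hi), naiveCoeff_val u v (mem_range.1 hi) n le_rfl,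
      sum_smul]
    exact sum_congr rfl fun a _ => mul_smul _ _ _
  rw [evalAt, sum_congr rfl h1, sum_comm, evalAt, sum_mul]
  refine sum_congr rfl fun a ha => ?_
  have ha := mem_range.1 ha
  rw [← smul_sum, sum_negExtend_shift hn hξ v (t := a)
    (by rw [Nat.sub_add_cancel (by omega), pow_two_mul_eq_one hξ]), smul_mul_assoc]

/-- The fast Fourier transform computes the values at the powers of `ξ ^ g`. -/
theorem evalAt_fft (hn : 0 < n) (hξ : ξ ^ n = -1) (l g : ℕ) (A : ℕ → ℕ → ZMod p)
    (hg : ∀ l', l = l' + 1 → ξ ^ (g * 2 ^ l') = -1) {i : ℕ} (hi : i < 2 ^ l) :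
    evalAt ξ n ((fft n l g A).val i) =
      ∑ j ∈ range (2 ^ l), (ξ ^ g) ^ (i * j) * evalAt ξ n (A j) := by
  induction l generalizing g A i with
  | zero =>
    obtain rfl : i = 0 := by simpa using hi
    simp [fft]
  | succ l ih =>
    have hgl : ξ ^ (g * 2 ^ l) = -1 := hg l rfl
    -- The half-length transforms use the squared root ω². The hypothesis is stated for l = l' + 1
    -- because a transform of length 1 needs no condition.
    have hg' : ∀ l', l = l' + 1 → ξ ^ (2 * g * 2 ^ l') = -1 := by
      rintro l' rfl
      rw [← hgl]
      congr 1
      ring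
    have hsplit : ∀ f : ℕ → R, ∑ j ∈ range (2 ^ (l + 1)), f j =
        ∑ j ∈ range (2 ^ l), (f (2 * j) + f (2 * j + 1)) := by
      intro f
      rw [pow_succ, Finset.sum_range_mul_eq]
      refine sum_congr rfl fun j _ => ?_
      rw [sum_range_succ, sum_range_one, add_zero, mul_comm]
    have hT : ∀ (Q : ℕ → ℕ → ZMod p) (j : ℕ), j < 2 ^ l →
        (tabulate (fun _ => (FieldOps.zero : ZMod p)) (2 ^ l)
          fun j => mulXPow n (g * j) (Q j)).val j = (mulXPow n (g * j) (Q j)).val :=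
      fun Q j hj => tabulate_val_of_lt _ _ hj
    rw [fft]
    simp only [Counted.bind_val]
    rw [tabulate_val_of_lt _ _ hi, hsplit]
    have even : ∀ j, (ξ ^ (2 * g)) ^ j = (ξ ^ g) ^ (2 * j) := by
      intro j; rw [← pow_mul, ← pow_mul]; congr 1; ring
    split_ifs with hil
    · rw [evalAt_addVec, hT _ _ hil, evalAt_mulXPow hn hξ, ih _ _ hg' hil, ih _ _ hg' hil, mul_sum,
        ← sum_add_distrib]
      refine sum_congr rfl fun j _ => ?_
      rw [even, pow_mul ξ g i]
      ring
    · obtain ⟨k, rfl⟩ : ∃ k, i = 2 ^ l + k := ⟨i - 2 ^ l, by omega⟩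
      have hk : k < 2 ^ l := by rw [pow_succ] at hi; omega
      rw [Nat.add_sub_cancel_left, evalAt_subVec, hT _ _ hk, evalAt_mulXPow hn hξ, ih _ _ hg' hk,
        ih _ _ hg' hk, mul_sum, ← sum_sub_distrib]
      refine sum_congr rfl fun j _ => ?_
      -- For an output index in the upper half, ω^(2^l) = -1 leaves the even terms unchanged and
      -- flips the odd ones: the subtraction of the butterfly.
      have hω : (ξ ^ g) ^ 2 ^ l = -1 := by rw [← pow_mul, hgl]
      have e1 : (ξ ^ g) ^ ((2 ^ l + k) * (2 * j)) = (ξ ^ g) ^ (2 * (k * j)) := by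
        rw [add_mul, pow_add, pow_mul, hω, pow_mul, neg_one_sq, one_pow, one_mul]
        congr 1; ring
      have e2 : (ξ ^ g) ^ ((2 ^ l + k) * (2 * j + 1)) = -((ξ ^ g) ^ k * (ξ ^ g) ^ (2 * (k * j))) := by
        rw [mul_add, mul_one, pow_add, e1, pow_add, hω]
        ring
      rw [e1, e2, even, pow_mul ξ g k]
      ring

end Evaluation

theorem twoPow_val (l : ℕ) : (twoPow l : Counted (ZMod p)).val = 2 ^ l := by
  induction l with
  | zero => simp [twoPow]
  | succ l ih => rw [twoPow, Counted.bind_val, FieldOps.add_val, ih, pow_succ]; ring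

end Algo

/-! ## Weighted Fourier inversion -/

section Fourier

open Finset

variable {R : Type} [CommRing R]

/-- The sum is the product of the factors 1 + x^(2^s) for s < l, one of which vanishes. No division
is needed, so zero divisors in `R` are harmless. -/
theorem geom_sum_two_pow_eq_zero {x : R} {i l : ℕ} (hil : i < l) (hx : x ^ 2 ^ i = -1) :
    ∑ j ∈ range (2 ^ l), x ^ j = 0 := by
  induction l with
  | zero => omega
  | succ l ih =>
    have h : ∑ j ∈ range (2 ^ (l + 1)), x ^ j = (1 + x ^ 2 ^ l) * ∑ j ∈ range (2 ^ l), x ^ j := by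
      rw [pow_succ, mul_two, sum_range_add, add_mul, one_mul, mul_sum]
      simp only [pow_add]
    rw [h]
    rcases Nat.lt_succ_iff_lt_or_eq.1 hil with h1 | rfl
    · rw [ih h1, mul_zero]
    · rw [hx, add_neg_cancel, zero_mul]

/-- The coefficient `1`, `-1` or `0` of `y ^ i` in `y ^ (a + b)` modulo `y ^ r + 1`. -/
def negSign (r i a b : ℕ) : ℤ := if a + b = i then 1 else if a + b = i + r then -1 else 0

/-- If e = 2^s o with o odd and s < l, the ratio x = θ^(2e) satisfies x^(2^(l-1-s)) = θ^(2^l o) =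
-1, and the geometric sum vanishes. Otherwise 2^l divides e, which leaves only e = 0 and e = 2^l
below 2·2^l. -/
theorem weighted_geom_sum {θ : R} {l e : ℕ} (hθ : θ ^ 2 ^ l = -1) (he : e < 2 * 2 ^ l) :
    θ ^ e * ∑ j ∈ range (2 ^ l), (θ ^ (2 * e)) ^ j =
      if e = 0 then 2 ^ l else if e = 2 ^ l then -2 ^ l else 0 := by
  split_ifs with h0 h1
  · simp [h0]
  · subst h1
    rw [mul_comm 2, pow_mul, hθ]
    simp
  · obtain ⟨s, o, ho, rfl⟩ := Nat.exists_eq_two_pow_mul_odd h0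
    have hs : s < l := by
      by_contra hsl
      obtain ⟨t, rfl⟩ := Nat.exists_eq_add_of_le (not_lt.1 hsl)
      have hpos : 0 < 2 ^ l := by positivity
      rw [pow_add, mul_assoc, mul_comm 2] at he
      have hlt := lt_of_mul_lt_mul_left he (Nat.zero_le _)
      have h1' : 2 ^ t * o ≠ 1 := by
        intro h
        rw [pow_add, mul_assoc, h, mul_one] at h1
        exact h1 rfl
      have : 2 ^ t * o ≠ 0 := by
        have := ho.pos
        positivity
      omega
    rw [geom_sum_two_pow_eq_zero (i := l - 1 - s) (by omega), mul_zero]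
    rw [← pow_mul]
    have : 2 * (2 ^ s * o) * 2 ^ (l - 1 - s) = 2 ^ l * o := by
      have : 2 ^ l = 2 * (2 ^ s * 2 ^ (l - 1 - s)) := by
        rw [← pow_add, ← pow_succ']
        congr 1
        omega
      rw [this]
      ring
    rw [this, pow_mul, hθ, ho.neg_one_pow]

/-- Convolution modulo `y ^ r + 1`, `r = 2 ^ l`, by weighted Fourier transforms of length `r`. -/
theorem weighted_dft_convolution {θ θ' : R} {l : ℕ} (hθ : θ ^ 2 ^ l = -1) (hinv : θ * θ' = 1)
    (u v : ℕ → R) {i : ℕ} (hi : i < 2 ^ l) :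
    θ' ^ i * ∑ j ∈ range (2 ^ l), (θ' ^ 2) ^ (i * j) *
        ((∑ a ∈ range (2 ^ l), (θ ^ 2) ^ (j * a) * (θ ^ a * u a)) *
          ∑ b ∈ range (2 ^ l), (θ ^ 2) ^ (j * b) * (θ ^ b * v b)) =
      2 ^ l * ∑ a ∈ range (2 ^ l), ∑ b ∈ range (2 ^ l), (negSign (2 ^ l) i a b : R) * (u a * v b) := by
  have hθ' : θ' ^ 2 ^ l = -1 := by
    have h : (θ * θ') ^ 2 ^ l = 1 := by rw [hinv, one_pow]
    rw [mul_pow, hθ, neg_one_mul] at h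
    rw [← neg_neg (θ' ^ 2 ^ l), h]
  have hcan : ∀ c d : ℕ, θ ^ (c + d) * θ' ^ d = θ ^ c := by
    intro c d
    rw [pow_add, mul_assoc, ← mul_pow, hinv, one_pow, mul_one]
  have hcan' : ∀ c d : ℕ, θ ^ d * θ' ^ (c + d) = θ' ^ c := by
    intro c d
    rw [pow_add, mul_left_comm, ← mul_pow, hinv, one_pow, mul_one]
  -- Orthogonality for the exponent a + b - i. Its sign decides whether a power of θ or of its
  -- inverse remains; in the second case the exponent is below 2^l, so the wrapped term cannot
  -- occur.
  have key : ∀ a ∈ range (2 ^ l), ∀ b ∈ range (2 ^ l),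
      θ ^ (a + b) * θ' ^ i * ∑ j ∈ range (2 ^ l), (θ ^ (2 * (a + b)) * θ' ^ (2 * i)) ^ j =
        2 ^ l * (negSign (2 ^ l) i a b : R) := by
    intro a ha b hb
    have ha := mem_range.1 ha
    have hb := mem_range.1 hb
    rcases le_total i (a + b) with h | h
    · obtain ⟨e, he⟩ := Nat.exists_eq_add_of_le' h
      rw [he, hcan, mul_add, hcan, weighted_geom_sum hθ (by omega), negSign, he]
      have h1 : e + i = i ↔ e = 0 := by omega
      have h2 : e + i = i + 2 ^ l ↔ e = 2 ^ l := by omega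
      simp only [h1, h2]
      split_ifs <;> simp
    · obtain ⟨e, he⟩ := Nat.exists_eq_add_of_le' h
      rw [he, hcan', mul_add 2 e, hcan', weighted_geom_sum hθ' (by omega), negSign]
      have h1 : a + b = e + (a + b) ↔ e = 0 := by omega
      have h2 : ¬ a + b = e + (a + b) + 2 ^ l := by omega
      have h3 : e ≠ 2 ^ l := by omega
      simp only [h1, h2, h3]
      split_ifs <;> simp
  have expand : ∀ j ∈ range (2 ^ l), (θ' ^ 2) ^ (i * j) *
        ((∑ a ∈ range (2 ^ l), (θ ^ 2) ^ (j * a) * (θ ^ a * u a)) *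
          ∑ b ∈ range (2 ^ l), (θ ^ 2) ^ (j * b) * (θ ^ b * v b)) =
      ∑ a ∈ range (2 ^ l), ∑ b ∈ range (2 ^ l), θ ^ (a + b) *
        (θ ^ (2 * (a + b)) * θ' ^ (2 * i)) ^ j * (u a * v b) := by
    intro j _
    rw [sum_mul_sum, mul_sum]
    refine sum_congr rfl fun a _ => ?_
    rw [mul_sum]
    refine sum_congr rfl fun b _ => ?_
    ring
  rw [sum_congr rfl expand, sum_comm, mul_sum, mul_sum]
  refine sum_congr rfl fun a ha => ?_
  rw [sum_comm, mul_sum, mul_sum]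
  refine sum_congr rfl fun b hb => ?_
  rw [← mul_assoc, ← key a ha b hb, mul_sum, mul_sum, sum_mul]
  refine sum_congr rfl fun j _ => ?_
  ring

end Fourier

/-! ## Correctness of the multiplication modulo `x ^ (2 ^ k) + 1` -/

namespace Algo

open Finset

variable {p : ℕ} [Fact p.Prime]

theorem coeff_evalAt_X (n : ℕ) (u : ℕ → ZMod p) (s : ℕ) :
    (evalAt (Polynomial.X : Polynomial (ZMod p)) n u).coeff s = if s < n then u s else 0 := by
  simp [evalAt, Polynomial.finsetSum_coeff, Polynomial.coeff_X_pow]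

theorem degree_evalAt_X_lt (n : ℕ) (u : ℕ → ZMod p) :
    (evalAt (Polynomial.X : Polynomial (ZMod p)) n u).degree < n := by
  rw [Polynomial.degree_lt_iff_coeff_zero]
  intro s hs
  rw [coeff_evalAt_X, if_neg (by omega)]

/-- Polynomials of degree less than `n` are determined modulo `x ^ n + 1`. -/
theorem eq_of_aeval_root_eq {n : ℕ} (hn : 0 < n) {P Q : Polynomial (ZMod p)} (hP : P.degree < n)
    (hQ : Q.degree < n)
    (h : Polynomial.aeval (AdjoinRoot.root (Polynomial.X ^ n + Polynomial.C (1 : ZMod p))) P =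
      Polynomial.aeval (AdjoinRoot.root (Polynomial.X ^ n + Polynomial.C (1 : ZMod p))) Q) :
    P = Q := by
  rw [← sub_eq_zero, ← map_sub, AdjoinRoot.aeval_eq, AdjoinRoot.mk_eq_zero] at h
  refine sub_eq_zero.1 (Polynomial.eq_zero_of_dvd_of_degree_lt h ?_)
  rw [Polynomial.degree_X_pow_add_C hn]
  exact (Polynomial.degree_sub_le _ _).trans_lt (max_lt hP hQ)

theorem root_pow_eq_neg_one (n : ℕ) :
    AdjoinRoot.root (Polynomial.X ^ n + Polynomial.C (1 : ZMod p)) ^ n = -1 := by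
  have h := AdjoinRoot.aeval_eq (f := Polynomial.X ^ n + Polynomial.C (1 : ZMod p))
    (Polynomial.X ^ n + Polynomial.C (1 : ZMod p))
  rw [AdjoinRoot.mk_self] at h
  simpa [eq_neg_iff_add_eq_zero] using h

/-- The intermediate arrays of `negMul`. -/
theorem negMul_eq_of_three_le {k : ℕ} (hk : ¬ k < 3) (u v : ℕ → ZMod p) :
    ∃ (U V U' V' W' W Z : Counted (ℕ → ℕ → ZMod p)) (c c' : Counted (ZMod p)),
      U = tabulate (fun _ => FieldOps.zero) (2 ^ (k - k / 2)) (fun j =>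
        mulXPow (2 * 2 ^ (k / 2)) (2 * 2 ^ (k / 2) / 2 ^ (k - k / 2) * j)
          fun i => if i < 2 ^ (k / 2) then u (j * 2 ^ (k / 2) + i) else FieldOps.zero) ∧
      V = tabulate (fun _ => FieldOps.zero) (2 ^ (k - k / 2)) (fun j =>
        mulXPow (2 * 2 ^ (k / 2)) (2 * 2 ^ (k / 2) / 2 ^ (k - k / 2) * j)
          fun i => if i < 2 ^ (k / 2) then v (j * 2 ^ (k / 2) + i) else FieldOps.zero) ∧
      U' = fft (2 * 2 ^ (k / 2)) (k - k / 2) (2 * (2 * 2 ^ (k / 2) / 2 ^ (k - k / 2))) U.val ∧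
      V' = fft (2 * 2 ^ (k / 2)) (k - k / 2) (2 * (2 * 2 ^ (k / 2) / 2 ^ (k - k / 2))) V.val ∧
      W' = tabulate (fun _ => FieldOps.zero) (2 ^ (k - k / 2)) (fun j =>
        negMul (k / 2 + 1) (U'.val j) (V'.val j)) ∧
      W = fft (2 * 2 ^ (k / 2)) (k - k / 2)
        (2 * (2 * 2 ^ (k / 2)) - 2 * (2 * 2 ^ (k / 2) / 2 ^ (k - k / 2))) W'.val ∧
      c = twoPow (k - k / 2) ∧
      c' = FieldOps.div FieldOps.one c.val ∧
      Z = tabulate (fun _ => FieldOps.zero) (2 ^ (k - k / 2)) (fun j =>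
        scaleShift (2 * 2 ^ (k / 2))
          (2 * (2 * 2 ^ (k / 2)) - 2 * 2 ^ (k / 2) / 2 ^ (k - k / 2) * j) c'.val (W.val j)) ∧
      negMul k u v =
        ⟨(tabulate FieldOps.zero (2 ^ k) fun q =>
          if q / 2 ^ (k / 2) = 0 then
            FieldOps.sub (Z.val 0 (q % 2 ^ (k / 2)))
              (Z.val (2 ^ (k - k / 2) - 1) (2 ^ (k / 2) + q % 2 ^ (k / 2)))
          else FieldOps.add (Z.val (q / 2 ^ (k / 2)) (q % 2 ^ (k / 2)))
            (Z.val (q / 2 ^ (k / 2) - 1) (2 ^ (k / 2) + q % 2 ^ (k / 2)))).val,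
          U.ops + (V.ops + (U'.ops + (V'.ops + (W'.ops + (W.ops + (c.ops + (c'.ops + (Z.ops +
            (tabulate FieldOps.zero (2 ^ k) fun q =>
              if q / 2 ^ (k / 2) = 0 then
                FieldOps.sub (Z.val 0 (q % 2 ^ (k / 2)))
                  (Z.val (2 ^ (k - k / 2) - 1) (2 ^ (k / 2) + q % 2 ^ (k / 2)))
              else FieldOps.add (Z.val (q / 2 ^ (k / 2)) (q % 2 ^ (k / 2)))
                (Z.val (q / 2 ^ (k / 2) - 1)
                  (2 ^ (k / 2) + q % 2 ^ (k / 2)))).ops))))))))⟩ := by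
  refine ⟨_, _, _, _, _, _, _, _, _, rfl, rfl, rfl, rfl, rfl, rfl, rfl, rfl, rfl, ?_⟩
  rw [negMul, dif_neg hk]
  rfl

/-! ### Cutting into blocks and reassembling them -/

section Blocks

variable {R : Type} [CommRing R] [Algebra (ZMod p) R]

theorem evalAt_mul_length (ξ : R) (r m : ℕ) (u : ℕ → ZMod p) :
    evalAt ξ (r * m) u = ∑ j ∈ range r, ξ ^ (m * j) * evalAt ξ m fun i => u (j * m + i) := by
  rw [evalAt, Finset.sum_range_mul_eq]
  refine sum_congr rfl fun j _ => ?_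
  rw [evalAt, mul_sum]
  refine sum_congr rfl fun i _ => ?_
  rw [mul_smul_comm, pow_add, mul_comm j m]

theorem evalAt_zeroPad (ξ : R) {m n : ℕ} (hmn : m ≤ n) (u : ℕ → ZMod p) :
    evalAt ξ n (fun i => if i < m then u i else FieldOps.zero) = evalAt ξ m u := by
  obtain ⟨d, rfl⟩ := Nat.exists_eq_add_of_le hmn
  rw [evalAt, sum_range_add, evalAt, sum_eq_zero (s := range d), add_zero]
  · exact sum_congr rfl fun i hi => by rw [if_pos (mem_range.1 hi)]
  · intro i _
    simp

/-- Substitution of `ξ ^ m` for `y` in overlapping blocks. -/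
theorem evalAt_overlap_add {ξ : R} {r m : ℕ} (hm : 0 < m) (hr : 0 < r) (hξ : ξ ^ (r * m) = -1)
    (Z : ℕ → ℕ → ZMod p) (w : ℕ → ZMod p)
    (hw : ∀ q < r * m, w q = if q / m = 0 then Z 0 (q % m) - Z (r - 1) (m + q % m)
      else Z (q / m) (q % m) + Z (q / m - 1) (m + q % m)) :
    evalAt ξ (r * m) w = ∑ j ∈ range r, ξ ^ (m * j) * evalAt ξ (2 * m) (Z j) := by
  have hsplit : ∀ j, evalAt ξ (2 * m) (Z j) =
      evalAt ξ m (Z j) + ξ ^ m * evalAt ξ m fun i => Z j (m + i) := by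
    intro j
    rw [evalAt_mul_length, sum_range_succ, sum_range_one]
    simp
  have hblock : ∀ j < r, (evalAt ξ m fun i => w (j * m + i)) = evalAt ξ m (Z j) +
      if j = 0 then -(evalAt ξ m fun i => Z (r - 1) (m + i))
      else evalAt ξ m fun i => Z (j - 1) (m + i) := by
    intro j hj
    have hq : ∀ i < m, (j * m + i) / m = j ∧ (j * m + i) % m = i ∧ j * m + i < r * m := by
      intro i hi
      refine ⟨?_, ?_, ?_⟩
      · rw [mul_comm, Nat.mul_add_div hm, Nat.div_eq_of_lt hi, add_zero]
      · rw [mul_comm, Nat.mul_add_mod, Nat.mod_eq_of_lt hi]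
      · calc j * m + i < (j + 1) * m := by rw [Nat.succ_mul]; omega
          _ ≤ r * m := Nat.mul_le_mul_right m hj
    split_ifs with h0
    · subst h0
      rw [← sub_eq_add_neg, evalAt, evalAt, evalAt, ← sum_sub_distrib]
      refine sum_congr rfl fun i hi => ?_
      obtain ⟨h1, h2, h3⟩ := hq i (mem_range.1 hi)
      rw [hw _ h3, h1, h2, if_pos rfl, sub_smul]
    · rw [evalAt, evalAt, evalAt, ← sum_add_distrib]
      refine sum_congr rfl fun i hi => ?_
      obtain ⟨h1, h2, h3⟩ := hq i (mem_range.1 hi)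
      rw [hw _ h3, h1, h2, if_neg h0, add_smul]
  rw [evalAt_mul_length]
  obtain ⟨r, rfl⟩ : ∃ r', r = r' + 1 := ⟨r - 1, by omega⟩
  have e1 : ∀ j ∈ range (r + 1), ξ ^ (m * j) * evalAt ξ m (fun i => w (j * m + i)) =
      ξ ^ (m * j) * evalAt ξ m (Z j) + ξ ^ (m * j) *
        (if j = 0 then -(evalAt ξ m fun i => Z (r + 1 - 1) (m + i))
          else evalAt ξ m fun i => Z (j - 1) (m + i)) := by
    intro j hj
    rw [hblock j (mem_range.1 hj), mul_add]
  have e2 : ∀ j ∈ range (r + 1), ξ ^ (m * j) * evalAt ξ (2 * m) (Z j) =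
      ξ ^ (m * j) * evalAt ξ m (Z j) +
        ξ ^ (m * (j + 1)) * evalAt ξ m fun i => Z j (m + i) := by
    intro j _
    rw [hsplit, mul_add, ← mul_assoc, ← pow_add, mul_add_one]
  rw [sum_congr rfl e1, sum_congr rfl e2, sum_add_distrib, sum_add_distrib]
  congr 1
  -- The upper half of block j lands on block j + 1; that of the last block lands on ξ^(rm) = -1,
  -- which accounts for the minus sign in block 0.
  rw [sum_range_succ', sum_range_succ, mul_comm m (r + 1), hξ]
  simp

end Blocks

/-- The product of two polynomials from the negacyclic products of their blocks. -/
theorem sum_negSign_blocks {R : Type} [CommRing R] {η : R} {r : ℕ} (hη : η ^ r = -1)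
    (B B' : ℕ → R) :
    ∑ i ∈ range r, η ^ i * ∑ a ∈ range r, ∑ b ∈ range r,
        (negSign r i a b : R) * (B a * B' b) =
      (∑ a ∈ range r, η ^ a * B a) * ∑ b ∈ range r, η ^ b * B' b := by
  rw [sum_mul_sum]
  simp only [mul_sum]
  rw [sum_comm]
  refine sum_congr rfl fun a ha => ?_
  rw [sum_comm]
  refine sum_congr rfl fun b hb => ?_
  have ha := mem_range.1 ha
  have hb := mem_range.1 hb
  -- For given a and b a single i contributes: a + b, or a + b - r with a minus sign matching η^r =
  -- -1.
  by_cases h : a + b < r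
  · rw [sum_eq_single (a + b)]
    · simp [negSign]; ring
    · intro i _ hi
      have h1 : ¬ a + b = i := fun h => hi h.symm
      have h2 : ¬ a + b = i + r := by omega
      simp [negSign, h1, h2]
    · intro h'
      exact absurd (mem_range.2 h) h'
  · rw [sum_eq_single (a + b - r)]
    · have h1 : ¬ a + b = a + b - r := by omega
      have h2 : a + b = a + b - r + r := by omega
      have h3 : η ^ a * η ^ b = η ^ (a + b - r) * η ^ r := by
        rw [← pow_add, ← pow_add, ← h2]
      rw [negSign, if_neg h1, if_pos h2]
      rw [hη] at h3
      push_cast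
      linear_combination (-(B a * B' b)) * h3
    · intro i _ hi
      have h1 : ¬ a + b = i + r := by omega
      have h2 : a + b = i → False := by
        intro h; subst h; have := mem_range.1 ‹_›; omega
      simp [negSign, h1]
      intro h; exact absurd h h2
    · intro h'
      exact absurd (mem_range.2 (by omega)) h'

theorem two_pow_ne_zero_of_ne_two (hp : p ≠ 2) (l : ℕ) : (2 : ZMod p) ^ l ≠ 0 := by
  apply pow_ne_zero
  intro h
  have h2 : ((2 : ℕ) : ZMod p) = 0 := by exact_mod_cast h
  rw [ZMod.natCast_eq_zero_iff, Nat.prime_dvd_prime_iff_eq Fact.out Nat.prime_two] at h2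
  exact hp h2

/-- The Schönhage–Strassen routine multiplies modulo `x ^ (2 ^ k) + 1` in odd characteristic. -/
theorem evalAt_negMul (hp : p ≠ 2) (k : ℕ) (u v : ℕ → ZMod p) {R : Type} [CommRing R]
    [Algebra (ZMod p) R] {ξ : R} (hξ : ξ ^ 2 ^ k = -1) :
    evalAt ξ (2 ^ k) (negMul k u v).val = evalAt ξ (2 ^ k) u * evalAt ξ (2 ^ k) v := by
  -- The algebra varies too: the recursive products are evaluated where ζ^(2m) = -1, unrelated to
  -- the given ξ.
  induction k using Nat.strong_induction_on generalizing u v R with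
  | _ k ih =>
    by_cases hk : k < 3
    · rw [negMul, dif_pos hk]
      exact evalAt_naive (by positivity) hξ u v
    obtain ⟨U, V, U', V', W', W, Z, c, c', hU, hV, hU', hV', hW', hW, hc, hc', hZ, hval⟩ :=
      negMul_eq_of_three_le hk u v
    set l := k - k / 2 with hl
    set m := 2 ^ (k / 2) with hm
    set g := 2 * m / 2 ^ l with hg
    have hmpos : 0 < m := by positivity
    have hnpos : 0 < 2 * m := by positivity
    have hn2 : 2 * m = 2 ^ (k / 2 + 1) := by rw [pow_succ, mul_comm]
    -- The division defining g is exact because k - k/2 ≤ k/2 + 1; thus ζ^g is a 2^l-th root of -1,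
    -- as the weights require.
    have hgr : g * 2 ^ l = 2 * m := by
      rw [hg, hn2]
      exact Nat.div_mul_cancel (pow_dvd_pow 2 (by omega))
    have hrm : 2 ^ l * m = 2 ^ k := by rw [hm, ← pow_add]; congr 1; omega
    have hl1 : 1 ≤ l := by omega
    have hg2 : 2 * g ≤ 2 * m := by
      rw [← hgr, mul_comm 2 g]
      exact Nat.mul_le_mul_left g (Nat.le_self_pow (by omega) 2)
    have hring : ∀ {S : Type} [CommRing S] [Algebra (ZMod p) S] {ζ : S}, ζ ^ (2 * m) = -1 →
        ∀ i < 2 ^ l, evalAt ζ (2 * m) (Z.val i) =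
          ∑ a ∈ range (2 ^ l), ∑ b ∈ range (2 ^ l), (negSign (2 ^ l) i a b : S) *
            ((evalAt ζ m fun t => u (a * m + t)) * evalAt ζ m fun t => v (b * m + t)) := by
      intro S _ _ ζ hζn i hi
      have hζg : (ζ ^ g) ^ 2 ^ l = -1 := by rw [← pow_mul, hgr, hζn]
      have hcan : ∀ t, t ≤ 2 * (2 * m) → ζ ^ t * ζ ^ (2 * (2 * m) - t) = 1 := by
        intro t ht
        rw [← pow_add, Nat.add_sub_cancel' ht, pow_two_mul_eq_one hζn]
      have hinv : ζ ^ g * ζ ^ (2 * (2 * m) - g) = 1 := hcan g (by omega)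
      have hgi : g * i ≤ 2 * (2 * m) := by
        have : g * i ≤ g * 2 ^ l := Nat.mul_le_mul_left g hi.le
        omega
      -- Uniqueness of inverses identifies the powers with subtracted exponents used by the routine
      -- as powers of θ' = ζ^(4m - g), the inverse of θ = ζ^g.
      have huniq : ∀ x y z : S,
          x * y = 1 → x * z = 1 → y = z := by
        intro x y z hy hz
        linear_combination z * hy - y * hz
      have hθi : ζ ^ (2 * (2 * m) - g * i) = (ζ ^ (2 * (2 * m) - g)) ^ i := by
        refine huniq (ζ ^ (g * i)) _ _ (hcan _ hgi) ?_
        rw [pow_mul, ← mul_pow, hinv, one_pow]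
      have hθ2 : ζ ^ (2 * (2 * m) - 2 * g) = (ζ ^ (2 * (2 * m) - g)) ^ 2 := by
        refine huniq (ζ ^ (2 * g)) _ _ (hcan _ (by omega)) ?_
        rw [mul_comm 2 g, pow_mul, ← mul_pow, hinv, one_pow]
      have hfwd : ∀ l', l = l' + 1 → ζ ^ (2 * g * 2 ^ l') = -1 := by
        intro l' hl'
        rw [mul_comm 2 g, mul_assoc, ← pow_succ' 2 l', ← hl', hgr, hζn]
      have hbwd : ∀ l', l = l' + 1 → ζ ^ ((2 * (2 * m) - 2 * g) * 2 ^ l') = -1 := by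
        intro l' hl'
        rw [pow_mul, hθ2, ← pow_mul, ← pow_succ' 2 l', ← hl']
        have h : (ζ ^ g * ζ ^ (2 * (2 * m) - g)) ^ 2 ^ l = 1 := by rw [hinv, one_pow]
        rw [mul_pow, hζg, neg_one_mul] at h
        rw [← neg_neg ((ζ ^ (2 * (2 * m) - g)) ^ 2 ^ l), h]
      have hUj : ∀ (w : ℕ → ZMod p) (A : Counted (ℕ → ℕ → ZMod p)),
          A = tabulate (fun _ => FieldOps.zero) (2 ^ l) (fun j => mulXPow (2 * m) (g * j)
            fun i => if i < m then w (j * m + i) else FieldOps.zero) →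
          ∀ j < 2 ^ l, evalAt ζ (2 * m) ((fft (2 * m) l (2 * g) A.val).val j) =
            ∑ a ∈ range (2 ^ l), ((ζ ^ g) ^ 2) ^ (j * a) *
              ((ζ ^ g) ^ a * evalAt ζ m fun t => w (a * m + t)) := by
        rintro w A rfl j hj
        rw [evalAt_fft hnpos hζn _ _ _ hfwd hj]
        refine sum_congr rfl fun a ha => ?_
        rw [tabulate_val_of_lt _ _ (mem_range.1 ha), evalAt_mulXPow hnpos hζn,
          evalAt_zeroPad ζ (by omega) fun i => w (a * m + i), ← pow_mul ζ g a, ← pow_mul ζ g 2,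
          mul_comm 2 g]
      have hWj : ∀ j ∈ range (2 ^ l), (ζ ^ (2 * (2 * m) - 2 * g)) ^ (i * j) *
          evalAt ζ (2 * m) (W'.val j) = ((ζ ^ (2 * (2 * m) - g)) ^ 2) ^ (i * j) *
            ((∑ a ∈ range (2 ^ l), ((ζ ^ g) ^ 2) ^ (j * a) *
              ((ζ ^ g) ^ a * evalAt ζ m fun t => u (a * m + t))) *
            ∑ b ∈ range (2 ^ l), ((ζ ^ g) ^ 2) ^ (j * b) *
              ((ζ ^ g) ^ b * evalAt ζ m fun t => v (b * m + t))) := by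
        intro j hj
        have hj := mem_range.1 hj
        have hmul := ih (k / 2 + 1) (by omega) (U'.val j) (V'.val j) (ξ := ζ)
          (by rw [← hn2, hζn])
        rw [← hn2] at hmul
        rw [hθ2, hW', tabulate_val_of_lt _ _ hj, hmul, hU', hV', hUj u U hU j hj,
          hUj v V hV j hj]
      rw [hZ, tabulate_val_of_lt _ _ hi, evalAt_scaleShift hnpos hζn, hW,
        evalAt_fft hnpos hζn _ _ _ hbwd hi, sum_congr rfl hWj, hθi,
        weighted_dft_convolution hζg hinv _ _ hi, hc', FieldOps.div_val, hc, twoPow_val,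
        FieldOps.one_zmod]
      -- The transforms return 2^l times the convolution; the scaling by 1/2^l cancels it, which is
      -- where p ≠ 2 enters.
      have h2 : (2 : S) ^ l =
          algebraMap (ZMod p) _ (2 ^ l) := by rw [map_pow, map_ofNat]
      rw [h2, ← Algebra.smul_def, smul_smul, one_div,
        inv_mul_cancel₀ (two_pow_ne_zero_of_ne_two hp l), one_smul]
    -- the blocks of the product, as polynomials
    have hblock : ∀ i < 2 ^ l, evalAt (Polynomial.X : Polynomial (ZMod p)) (2 * m) (Z.val i) =
        ∑ a ∈ range (2 ^ l), ∑ b ∈ range (2 ^ l), (negSign (2 ^ l) i a b : Polynomial (ZMod p)) *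
          ((evalAt Polynomial.X m fun t => u (a * m + t)) *
            evalAt Polynomial.X m fun t => v (b * m + t)) := by
      intro i hi
      -- Products of two blocks of length m have degree less than 2m, so the identity modulo x^(2m)
      -- + 1 lifts to polynomials and can then be evaluated at ξ, although ξ^(2m) need not be -1.
      refine eq_of_aeval_root_eq hnpos (degree_evalAt_X_lt _ _) ?_ ?_
      · rw [← Polynomial.mem_degreeLT]
        refine Submodule.sum_mem _ fun a _ => Submodule.sum_mem _ fun b _ => ?_
        rw [← zsmul_eq_mul]
        refine zsmul_mem ?_ _
        rw [Polynomial.mem_degreeLT, Polynomial.degree_lt_iff_coeff_zero]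
        intro s hs
        rw [Polynomial.coeff_mul]
        refine sum_eq_zero fun x hx => ?_
        rw [Finset.HasAntidiagonal.mem_antidiagonal] at hx
        rw [coeff_evalAt_X, coeff_evalAt_X]
        by_cases h1 : x.1 < m
        · rw [if_neg (by omega : ¬ x.2 < m), mul_zero]
        · rw [if_neg h1, zero_mul]
      · have h := hring (root_pow_eq_neg_one (p := p) (2 * m)) i hi
        simp only [map_sum, map_mul, map_intCast, map_evalAt, Polynomial.aeval_X]
        exact h
    rw [hval]
    have hξ' : ξ ^ (2 ^ l * m) = -1 := by rw [hrm, hξ]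
    rw [← hrm, evalAt_overlap_add hmpos (by positivity) hξ' Z.val]
    · rw [evalAt_mul_length, evalAt_mul_length]
      have hη : (ξ ^ m) ^ 2 ^ l = -1 := by rw [← pow_mul, mul_comm, hξ']
      simp only [pow_mul ξ m]
      rw [← sum_negSign_blocks hη]
      refine sum_congr rfl fun i hi => ?_
      have h := congrArg (Polynomial.aeval ξ) (hblock i (mem_range.1 hi))
      simp only [map_sum, map_mul, map_intCast, map_evalAt, Polynomial.aeval_X] at h
      rw [h]
    · intro q hq
      rw [hrm] at hq
      simp only [hrm]
      rw [tabulate_val_of_lt _ _ hq]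
      split_ifs <;> rfl

end Algo

/-! ## Correctness of the algorithm -/

namespace Algo

open Finset

variable {p : ℕ} [Fact p.Prime]

/-- Kronecker's substitution `x = y ^ w`. -/
noncomputable def kronecker (w : ℕ) :
    MvPolynomial (Fin 2) (ZMod p) →ₐ[ZMod p] Polynomial (ZMod p) :=
  MvPolynomial.aeval ![Polynomial.X ^ w, Polynomial.X]

theorem kronecker_monomial (w i j : ℕ) (c : ZMod p) :
    kronecker w (MvPolynomial.monomial (expo i j) c) = Polynomial.monomial (i * w + j) c := by
  rw [kronecker, MvPolynomial.aeval_monomial, Finsupp.prod_fintype _ _ (by simp),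
    Fin.prod_univ_two]
  simp only [Matrix.cons_val_zero, Matrix.cons_val_one, expo_apply_zero, expo_apply_one]
  rw [← pow_mul, ← pow_add, mul_comm w, Polynomial.algebraMap_eq, Polynomial.C_mul_X_pow_eq_monomial]

theorem eq_mul_add_iff {w i j s : ℕ} (hj : j < w) : i * w + j = s ↔ s / w = i ∧ s % w = j := by
  constructor
  · rintro rfl
    rw [mul_comm, Nat.mul_add_div (by omega), Nat.div_eq_of_lt hj, Nat.mul_add_mod,
      Nat.mod_eq_of_lt hj]
    simp
  · rintro ⟨rfl, rfl⟩
    rw [mul_comm]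
    exact Nat.div_add_mod s w

theorem coeff_kronecker {w X Y : ℕ} (hY : Y < w) {P : MvPolynomial (Fin 2) (ZMod p)}
    (hP : BiDegreeLE X Y P) (s : ℕ) :
    (kronecker w P).coeff s = P.coeff (expo (s / w) (s % w)) := by
  conv_lhs => rw [hP.eq_sum]
  conv_rhs => rw [hP.eq_sum]
  rw [map_sum, Polynomial.finsetSum_coeff, MvPolynomial.coeff_sum]
  refine sum_congr rfl fun t _ => ?_
  rw [kronecker_monomial, Polynomial.coeff_monomial, MvPolynomial.coeff_monomial]
  have ht := t.2.2
  have h : (t.1 : ℕ) * w + t.2 = s ↔ expo (t.1 : ℕ) t.2 = expo (s / w) (s % w) := by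
    rw [eq_mul_add_iff (by omega)]
    constructor
    · rintro ⟨h1, h2⟩; rw [h1, h2]
    · intro h
      have e0 := DFunLike.congr_fun h 0
      have e1 := DFunLike.congr_fun h 1
      simp only [expo_apply_zero, expo_apply_one] at e0 e1
      exact ⟨e0.symm, e1.symm⟩
  simp only [h]

theorem mul_add_lt_of_le {X w i j : ℕ} (hi : i ≤ X) (hj : j < w) : i * w + j < (X + 1) * w :=
  calc i * w + j < (i + 1) * w := by rw [Nat.succ_mul]; omega
    _ ≤ (X + 1) * w := Nat.mul_le_mul_right w (by omega)

theorem coeff_kronecker_eq_zero {w X Y s : ℕ} (hY : Y < w) {P : MvPolynomial (Fin 2) (ZMod p)}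
    (hP : BiDegreeLE X Y P) (hs : (X + 1) * w ≤ s) : (kronecker w P).coeff s = 0 := by
  rw [coeff_kronecker hY hP]
  by_contra hc
  have h1 := mul_add_lt_of_le (hP _ _ hc).1 (Nat.mod_lt s (by omega : 0 < w))
  rw [mul_comm, Nat.div_add_mod] at h1
  omega

theorem evalAt_kronecker {w X Y n : ℕ} (hY : Y < w) (hn : (X + 1) * w ≤ n)
    {P : MvPolynomial (Fin 2) (ZMod p)} (hP : BiDegreeLE X Y P) {u : ℕ → ℕ → ZMod p}
    (hu : ∀ i j, u i j = P.coeff (expo i j)) :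
    evalAt (Polynomial.X : Polynomial (ZMod p)) n
      (fun s => if s / w ≤ X ∧ s % w ≤ Y then u (s / w) (s % w) else FieldOps.zero) =
        kronecker w P := by
  ext s
  rw [coeff_evalAt_X]
  split_ifs with h1 h2
  · rw [coeff_kronecker hY hP, hu]
  · rw [coeff_kronecker hY hP]
    by_contra hc
    exact h2 (hP _ _ (Ne.symm hc))
  · rw [coeff_kronecker_eq_zero hY hP (by omega)]

/-- Since w exceeds the y-degree of the product, distinct monomials stay distinct under Kronecker's
substitution; since 2^k is at least (X₁ + X₂ + 1)w, nothing wraps around modulo x^(2^k) + 1. -/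
theorem biMul_val (hp : p ≠ 2) {X₁ Y₁ X₂ Y₂ : ℕ} {P Q : MvPolynomial (Fin 2) (ZMod p)}
    (hP : BiDegreeLE X₁ Y₁ P) (hQ : BiDegreeLE X₂ Y₂ Q) {u v : ℕ → ℕ → ZMod p}
    (hu : ∀ i j, u i j = P.coeff (expo i j)) (hv : ∀ i j, v i j = Q.coeff (expo i j)) (i j : ℕ) :
    (biMul X₁ Y₁ X₂ Y₂ u v).val i j = (P * Q).coeff (expo i j) := by
  rw [biMul]
  simp only [Counted.bind_val, Counted.pure_val]
  have hPQ := hP.mul hQ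
  set w := Y₁ + Y₂ + 1 with hw
  set k := Nat.clog 2 ((X₁ + X₂ + 1) * w) with hk
  have hsize : (X₁ + X₂ + 1) * w ≤ 2 ^ k := Nat.le_pow_clog (by norm_num) _
  set c := (negMul k (fun s => if s / w ≤ X₁ ∧ s % w ≤ Y₁ then u (s / w) (s % w) else FieldOps.zero)
    (fun s => if s / w ≤ X₂ ∧ s % w ≤ Y₂ then v (s / w) (s % w) else FieldOps.zero)).val with hc
  have key : evalAt (Polynomial.X : Polynomial (ZMod p)) (2 ^ k) c = kronecker w (P * Q) := by
    refine eq_of_aeval_root_eq (by positivity) (degree_evalAt_X_lt _ _) ?_ ?_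
    · rw [Polynomial.degree_lt_iff_coeff_zero]
      intro s hs
      exact coeff_kronecker_eq_zero (by omega) hPQ (by omega)
    · have hroot := root_pow_eq_neg_one (p := p) (2 ^ k)
      have hmul := evalAt_negMul hp k
        (fun s => if s / w ≤ X₁ ∧ s % w ≤ Y₁ then u (s / w) (s % w) else FieldOps.zero)
        (fun s => if s / w ≤ X₂ ∧ s % w ≤ Y₂ then v (s / w) (s % w) else FieldOps.zero) hroot
      have h1 := evalAt_kronecker (w := w) (n := 2 ^ k) (by omega)
        ((Nat.mul_le_mul_right w (by omega)).trans hsize) hP hu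
      have h2 := evalAt_kronecker (w := w) (n := 2 ^ k) (by omega)
        ((Nat.mul_le_mul_right w (by omega)).trans hsize) hQ hv
      rw [map_evalAt, Polynomial.aeval_X, hc, hmul, map_mul, map_mul, ← h1, ← h2, map_evalAt,
        map_evalAt, Polynomial.aeval_X]
  split_ifs with h
  · have hj : j < w := by omega
    have hlt := (mul_add_lt_of_le h.1 hj).trans_le hsize
    have h1 := congrArg (fun F => Polynomial.coeff F (i * w + j)) key
    simp only [coeff_evalAt_X, if_pos hlt] at h1
    obtain ⟨e1, e2⟩ := (eq_mul_add_iff (i := i) hj).1 rfl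
    rw [h1, coeff_kronecker (by omega) hPQ, e1, e2]
  · by_contra hne
    exact h (hPQ _ _ (Ne.symm hne))

/-- For n ≤ 1 no product is formed, so characteristic two is allowed there; this suffices because p
- 1 = 1 when p = 2. -/
theorem biPow_val (X Y : ℕ) {P : MvPolynomial (Fin 2) (ZMod p)} (hP : BiDegreeLE X Y P)
    {b : ℕ → ℕ → ZMod p} (hb : ∀ i j, b i j = P.coeff (expo i j)) (n : ℕ) (hn : p ≠ 2 ∨ n ≤ 1)
    (i j : ℕ) : (biPow X Y b n).val i j = (P ^ n).coeff (expo i j) := by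
  induction n using Nat.strong_induction_on generalizing i j with
  | _ n ih =>
    rw [biPow]
    by_cases h0 : n = 0
    · subst h0
      rw [dif_pos rfl]
      rw [Counted.pure_val, pow_zero, MvPolynomial.coeff_one]
      have : (0 = expo i j) ↔ i = 0 ∧ j = 0 := by
        constructor
        · intro h
          have e0 := DFunLike.congr_fun h 0
          have e1 := DFunLike.congr_fun h 1
          simp at e0 e1
          omega
        · rintro ⟨rfl, rfl⟩
          exact expo_zero_zero.symm
      simp only [this]
      rfl
    rw [dif_neg h0]
    by_cases h1 : n = 1
    · rw [if_pos h1, Counted.pure_val, hb, h1, pow_one]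
    · rw [if_neg h1]
      have hp : p ≠ 2 := hn.resolve_right (by omega)
      have hq := ih (n / 2) (by omega) (Or.inl hp)
      have hPe := hP.pow (n / 2)
      have hs : ∀ i j, (biMul (n / 2 * X) (n / 2 * Y) (n / 2 * X) (n / 2 * Y)
          (biPow X Y b (n / 2)).val (biPow X Y b (n / 2)).val).val i j =
            (P ^ (2 * (n / 2))).coeff (expo i j) := by
        intro i j
        rw [biMul_val hp hPe hPe hq hq, ← pow_add, two_mul]
      simp only [Counted.bind_val]
      split_ifs with hmod
      · rw [Counted.pure_val, hs, show 2 * (n / 2) = n by omega]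
      · rw [biMul_val hp (hP.pow (2 * (n / 2))) hP hs hb, ← pow_succ,
          show 2 * (n / 2) + 1 = n by omega]

theorem intTable_val (n i : ℕ) (hi : i ≤ n) : (intTable n : Counted (ℕ → ZMod p)).val i = i := by
  induction n generalizing i with
  | zero =>
    obtain rfl : i = 0 := by omega
    simp [intTable]
  | succ n ih =>
    rw [intTable]
    simp only [Counted.bind_val, Counted.pure_val, FieldOps.add_val]
    split_ifs with h
    · rw [ih n le_rfl, h]
      simp
    · exact ih i (by omega)

/-- The coefficients of `a`, as computed by the algorithm. -/
theorem numTable_eq {E : MvPolynomial (Fin 2) (ZMod p)} {h d : ℕ} (hx : E.degreeOf 0 ≤ h)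
    (hy : E.degreeOf 1 ≤ d) (i j : ℕ) :
    (if i ≤ h ∧ i ≤ j ∧ j - i ≤ d then
      (tabulate (fun _ => FieldOps.zero) (h + 1) fun i =>
        tabulate FieldOps.zero (d + 1) fun j =>
          FieldOps.mul ((intTable d : Counted (ℕ → ZMod p)).val j) (E.coeff (expo i j))).val i (j - i)
      else FieldOps.zero) = (diagNum E).coeff (expo i j) := by
  rw [coeff_diagNum]
  split_ifs with h1 h2 h2
  · rw [tabulate_val_of_lt _ _ (by omega), tabulate_val_of_lt _ _ (by omega), FieldOps.mul_val,
      intTable_val _ _ h1.2.2]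
  · omega
  · by_contra hne
    have := degrees_of_coeff_ne_zero hx hy (right_ne_zero_of_mul (Ne.symm hne))
    omega
  · rfl

theorem denTable_eq {E : MvPolynomial (Fin 2) (ZMod p)} {h d : ℕ} (hx : E.degreeOf 0 ≤ h)
    (hy : E.degreeOf 1 ≤ d) (i j : ℕ) :
    (if i ≤ h ∧ i ≤ j + 1 ∧ j + 1 - i ≤ d then E.coeff (expo i (j + 1 - i)) else FieldOps.zero) =
      (diagDen E).coeff (expo i j) := by
  rw [coeff_diagDen]
  split_ifs with h1 h2 h2
  · rfl
  · omega
  · by_contra hne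
    have := degrees_of_coeff_ne_zero hx hy (Ne.symm hne)
    omega
  · rfl

/-- The partial degrees, as computed by the algorithm. -/
theorem sup_support_eq {E : MvPolynomial (Fin 2) (ZMod p)} {h d : ℕ} (hx : E.degreeOf 0 ≤ h)
    (hy : E.degreeOf 1 ≤ d) (k : Fin 2) :
    (((range (h + 1) ×ˢ range (d + h + 1)).filter fun s =>
      FieldOps.isZero ((diagNum E).coeff (expo s.1 s.2)) = false ∨
        FieldOps.isZero ((diagDen E).coeff (expo s.1 s.2)) = false).sup
          fun s => expo s.1 s.2 k) =
      max ((diagNum E).degreeOf k) ((diagDen E).degreeOf k) := by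
  simp only [FieldOps.isZero_eq_false_iff]
  apply le_antisymm
  · refine Finset.sup_le fun s hs => ?_
    rcases (mem_filter.1 hs).2 with hc | hc
    · exact le_max_of_le_left
        (MvPolynomial.monomial_le_degreeOf k (MvPolynomial.mem_support_iff.2 hc))
    · exact le_max_of_le_right
        (MvPolynomial.monomial_le_degreeOf k (MvPolynomial.mem_support_iff.2 hc))
  · have hmem : ∀ i j, ((diagNum E).coeff (expo i j) ≠ 0 ∨ (diagDen E).coeff (expo i j) ≠ 0) →
        expo i j k ≤ ((range (h + 1) ×ˢ range (d + h + 1)).filter fun s =>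
          (diagNum E).coeff (expo s.1 s.2) ≠ 0 ∨ (diagDen E).coeff (expo s.1 s.2) ≠ 0).sup
            fun s => expo s.1 s.2 k := by
      intro i j hc
      have hb := degrees_of_coeff_diag_ne_zero hx hy i j hc
      exact Finset.le_sup (f := fun s : ℕ × ℕ => expo s.1 s.2 k) (b := (i, j))
        (mem_filter.2 ⟨mem_product.2 ⟨mem_range.2 (by omega), mem_range.2 (by omega)⟩, hc⟩)
    exact max_le (degreeOf_le_of_coeff fun i j hc => hmem i j (Or.inl hc))
      (degreeOf_le_of_coeff fun i j hc => hmem i j (Or.inr hc))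

/-- The linear representation computed by the algorithm, and the cost of its computation. -/
theorem precompute_eq {E : MvPolynomial (Fin 2) (ZMod p)} {h d : ℕ} (hx : E.degreeOf 0 ≤ h)
    (hy : E.degreeOf 1 ≤ d) :
    ∃ (b : ℕ → ℕ → ZMod p), (∀ i j, b i j = (diagDen E).coeff (expo i j)) ∧
      precompute p h d (fun i j => E.coeff (expo i j)) =
        ⟨{  size := (diagDegX E + 1) * (diagDegY E + 1)
            row := fun s => if s = 0 then FieldOps.one else FieldOps.zero
            mat := fun r s s' =>
              if s' / (diagDegY E + 1) ≤ p * (s / (diagDegY E + 1)) + r ∧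
                  s' % (diagDegY E + 1) ≤ p * (s % (diagDegY E + 1)) + r then
                (biPow (diagDegX E) (diagDegY E) b (p - 1)).val
                  (p * (s / (diagDegY E + 1)) + r - s' / (diagDegY E + 1))
                  (p * (s % (diagDegY E + 1)) + r - s' % (diagDegY E + 1))
              else FieldOps.zero
            col := fun s => (diagNum E).coeff (expo (s / (diagDegY E + 1)) (s % (diagDegY E + 1)))
            den := (diagDen E).coeff (expo 0 0) },
          (intTable d : Counted (ℕ → ZMod p)).ops + ((h + 1) * (d + 1) +
            (biPow (diagDegX E) (diagDegY E) b (p - 1)).ops)⟩ := by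
  have ha := numTable_eq hx hy
  have hb := denTable_eq hx hy
  have h0 := sup_support_eq hx hy 0
  have h1 := sup_support_eq hx hy 1
  simp only [expo_apply_zero, expo_apply_one] at h0 h1
  refine ⟨fun i j => (diagDen E).coeff (expo i j), fun _ _ => rfl, ?_⟩
  have hops : (tabulate (fun _ => (FieldOps.zero : ZMod p)) (h + 1) fun i =>
        tabulate FieldOps.zero (d + 1) fun j =>
          FieldOps.mul ((intTable d : Counted (ℕ → ZMod p)).val j) (E.coeff (expo i j))).ops =
      (h + 1) * (d + 1) := by
    simp [tabulate_ops]
  rw [← hops]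
  have hcongr : ∀ x y : Counted (LinRep (ZMod p)), x.val = y.val → x.ops = y.ops → x = y := by
    rintro ⟨_, _⟩ ⟨_, _⟩ rfl rfl
    rfl
  apply hcongr
  · rw [precompute]
    simp only [Counted.bind_val, Counted.pure_val, ha, hb]
    unfold diagDegX diagDegY
    rw [← h0, ← h1]
  · rw [precompute]
    simp only [Counted.bind_ops, Counted.pure_ops, ha, hb, add_zero]
    unfold diagDegX diagDegY
    rw [← h0, ← h1]

/-! ### The digit loop and the value of the algorithm -/

theorem dot_val (u v : ℕ → ZMod p) (n : ℕ) : (dot u v n).val = ∑ i ∈ range n, u i * v i := by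
  induction n with
  | zero => simp [dot]
  | succ n ih => rw [sum_range_succ, ← ih]; rfl

theorem sum_range_eq_sum_pairs {M : Type*} [AddCommMonoid M] (dx dy : ℕ) (f : ℕ → M) :
    ∑ s ∈ range ((dx + 1) * (dy + 1)), f s =
      ∑ t : Fin (dx + 1) × Fin (dy + 1), f (t.1 * (dy + 1) + t.2) := by
  rw [Finset.sum_range_mul_eq, Fintype.sum_prod_type, Finset.sum_range]
  exact sum_congr rfl fun i _ => Finset.sum_range _

/-- The array `v` holds the coordinates `V` in the encoding of the basis `x ^ i y ^ j`. -/
def Encodes (dx dy : ℕ) (v : ℕ → ZMod p) (V : Fin (dx + 1) × Fin (dy + 1) → ZMod p) : Prop :=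
  ∀ t : Fin (dx + 1) × Fin (dy + 1), v (t.1 * (dy + 1) + t.2) = V t

theorem index_div_mod {dx dy : ℕ} (t : Fin (dx + 1) × Fin (dy + 1)) :
    ((t.1 : ℕ) * (dy + 1) + t.2) / (dy + 1) = t.1 ∧
      ((t.1 : ℕ) * (dy + 1) + t.2) % (dy + 1) = t.2 :=
  (eq_mul_add_iff t.2.2).1 rfl

theorem index_lt {dx dy : ℕ} (t : Fin (dx + 1) × Fin (dy + 1)) :
    (t.1 : ℕ) * (dy + 1) + t.2 < (dx + 1) * (dy + 1) :=
  mul_add_lt_of_le (Nat.lt_succ_iff.1 t.1.2) t.2.2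

theorem Encodes.matVec {dx dy : ℕ} {v : ℕ → ZMod p} {V : Fin (dx + 1) × Fin (dy + 1) → ZMod p}
    (hv : Encodes dx dy v V) {A : ℕ → ℕ → ZMod p}
    {M : Matrix (Fin (dx + 1) × Fin (dy + 1)) (Fin (dx + 1) × Fin (dy + 1)) (ZMod p)}
    (hA : ∀ s t, A (s.1 * (dy + 1) + s.2) (t.1 * (dy + 1) + t.2) = M s t) :
    Encodes dx dy (matVec ((dx + 1) * (dy + 1)) A v).val (M.mulVec V) := by
  intro s
  rw [Algo.matVec, tabulate_val_of_lt _ _ (index_lt s), dot_val, sum_range_eq_sum_pairs]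
  refine sum_congr rfl fun t _ => ?_
  rw [hA, hv t]

theorem Encodes.applyDigits {dx dy : ℕ} {R : LinRep (ZMod p)} (hsize : R.size = (dx + 1) * (dy + 1))
    {M : ℕ → Matrix (Fin (dx + 1) × Fin (dy + 1)) (Fin (dx + 1) × Fin (dy + 1)) (ZMod p)}
    (hA : ∀ r s t, R.mat r (s.1 * (dy + 1) + s.2) (t.1 * (dy + 1) + t.2) = M r s t)
    (digits : List ℕ) {v : ℕ → ZMod p} {V : Fin (dx + 1) × Fin (dy + 1) → ZMod p}
    (hv : Encodes dx dy v V) :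
    Encodes dx dy (applyDigits R digits v).val ((digits.reverse.map M).prod.mulVec V) := by
  induction digits generalizing v V with
  | nil => simpa [Algo.applyDigits] using hv
  | cons r rs ih =>
    rw [Algo.applyDigits, Counted.bind_val, List.reverse_cons, List.map_append, List.prod_append,
      List.map_singleton, List.prod_singleton, ← Matrix.mulVec_mulVec]
    exact ih (hsize ▸ hv.matVec (hA r))

/-- Multiplication by x^i y^j only shifts exponents, so every matrix entry is a coefficient of
b^(p-1) or zero and costs no operation. -/
theorem sectionMatrix_apply {b : MvPolynomial (Fin 2) (ZMod p)} {dx dy r : ℕ}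
    (s t : Fin (dx + 1) × Fin (dy + 1)) :
    sectionMatrix p b dx dy r s t =
      if (t.1 : ℕ) ≤ p * s.1 + r ∧ (t.2 : ℕ) ≤ p * s.2 + r then
        (b ^ (p - 1)).coeff (expo (p * s.1 + r - t.1) (p * s.2 + r - t.2)) else 0 := by
  rw [sectionMatrix, coeff_bisection, MvPolynomial.coeff_coe, MvPolynomial.coeff_monomial_mul']
  have h1 : p • expo (s.1 : ℕ) s.2 + expo r r = expo (p * s.1 + r) (p * s.2 + r) := by
    apply expo_ext <;> simp
  have h2 : expo (p * s.1 + r) (p * s.2 + r) - expo (t.1 : ℕ) t.2 =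
      expo (p * s.1 + r - t.1) (p * s.2 + r - t.2) := by
    apply expo_ext <;> simp
  rw [h1, h2, one_mul]
  simp only [expo_le_iff, expo_apply_zero, expo_apply_one]

theorem nthCoeffViaDiagonals_val {E : MvPolynomial (Fin 2) (ZMod p)} {h d : ℕ}
    (hx : E.degreeOf 0 ≤ h) (hy : E.degreeOf 1 ≤ d) (N : ℕ) :
    (nthCoeffViaDiagonals p h d (fun i j => E.coeff (expo i j)) N).val =
      evalVector (ZMod p) (diagDegX E) (diagDegY E) ⬝ᵥ
        (((Nat.digits p N).reverse.map
          (sectionMatrix p (diagDen E) (diagDegX E) (diagDegY E))).prod.mulVec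
            (coordVector (diagNum E) (diagDegX E) (diagDegY E))) /
        MvPolynomial.constantCoeff (diagDen E) := by
  obtain ⟨b, hb, hpre⟩ := precompute_eq hx hy
  rw [nthCoeffViaDiagonals, Counted.bind_val, evalLinRep]
  simp only [Counted.bind_val]
  set dx := diagDegX E with hdx
  set dy := diagDegY E with hdy
  have hR := congrArg Counted.val hpre
  set R := (precompute p h d fun i j => E.coeff (expo i j)).val
  clear_value R
  subst hR
  set R : LinRep (ZMod p) := LinRep.mk _ _ _ _ _
  set v := (tabulate (FieldOps.zero : ZMod p) R.size fun s => FieldOps.div (R.col s) R.den).val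
    with hvdef
  have hdeg : BiDegreeLE dx dy (diagDen E) := biDegreeLE_diagDen E
  have hsize : R.size = (dx + 1) * (dy + 1) := rfl
  -- The algorithm divides the column by b(0,0) beforehand; by linearity the scalar passes through
  -- all the matrices.
  have hv : Encodes dx dy v
      ((MvPolynomial.constantCoeff (diagDen E))⁻¹ • coordVector (diagNum E) dx dy) := by
    intro t
    obtain ⟨h1, h2⟩ := index_div_mod t
    rw [hvdef, tabulate_val_of_lt _ _ (hsize ▸ index_lt t), FieldOps.div_val]
    change (diagNum E).coeff (expo (_ / (dy + 1)) (_ % (dy + 1))) / (diagDen E).coeff (expo 0 0) = _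
    rw [h1, h2, expo_zero_zero, ← MvPolynomial.constantCoeff_eq, Pi.smul_apply, coordVector,
      smul_eq_mul, div_eq_inv_mul]
  have hA : ∀ r s t, R.mat r (s.1 * (dy + 1) + s.2) (t.1 * (dy + 1) + t.2) =
      sectionMatrix p (diagDen E) dx dy r s t := by
    intro r s t
    obtain ⟨h1, h2⟩ := index_div_mod s
    obtain ⟨h3, h4⟩ := index_div_mod t
    rw [sectionMatrix_apply]
    change (if _ / (dy + 1) ≤ p * (_ / (dy + 1)) + r ∧ _ % (dy + 1) ≤ p * (_ % (dy + 1)) + r then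
      (biPow dx dy b (p - 1)).val (p * (_ / (dy + 1)) + r - _ / (dy + 1))
        (p * (_ % (dy + 1)) + r - _ % (dy + 1)) else FieldOps.zero) = _
    rw [h1, h2, h3, h4]
    split_ifs
    · apply biPow_val dx dy hdeg hb
      by_cases hp : p = 2
      · exact Or.inr (by omega)
      · exact Or.inl hp
    · rfl
  have hfin := hv.applyDigits hsize hA (Nat.digits p N)
  rw [dot_val, hsize, sum_range_eq_sum_pairs, dotProduct, Finset.sum_div]
  refine sum_congr rfl fun t _ => ?_
  rw [hfin t, Matrix.mulVec_smul, Pi.smul_apply, smul_eq_mul, evalVector]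
  change (if _ = 0 then FieldOps.one else FieldOps.zero) * _ = _
  have ht : (t.1 : ℕ) * (dy + 1) + t.2 = 0 ↔ t = (0, 0) := by
    rw [Prod.ext_iff, Fin.ext_iff, Fin.ext_iff]
    simp
  simp only [ht, FieldOps.one_zmod, FieldOps.zero_zmod]
  split_ifs <;> simp [div_eq_inv_mul]

end Algo

/-! ## Number of arithmetic operations -/

namespace Algo

open Finset

variable {p : ℕ} [Fact p.Prime]

theorem tabulate_ops_le {α : Type} (z : α) (n c : ℕ) (f : ℕ → Counted α)
    (h : ∀ i < n, (f i).ops ≤ c) : (tabulate z n f).ops ≤ n * c := by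
  rw [tabulate_ops]
  simpa using sum_le_card_nsmul (range n) _ c fun i hi => h i (mem_range.1 hi)

theorem mulXPow_ops_le (n t : ℕ) (u : ℕ → ZMod p) : (mulXPow n t u).ops ≤ n := by
  refine (tabulate_ops_le _ n 1 _ fun i _ => ?_).trans_eq (mul_one n)
  dsimp only
  split_ifs <;> simp

theorem scaleShift_ops_le (n t : ℕ) (c : ZMod p) (u : ℕ → ZMod p) :
    (scaleShift n t c u).ops ≤ 2 * n := by
  rw [scaleShift, Counted.bind_ops, two_mul]
  exact add_le_add (mulXPow_ops_le n t u)
    ((tabulate_ops_le _ n 1 _ fun i _ => le_rfl).trans_eq (mul_one n))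

theorem addVec_ops_le (n : ℕ) (u v : ℕ → ZMod p) : (addVec n u v).ops ≤ n :=
  (tabulate_ops_le _ n 1 _ fun _ _ => le_rfl).trans_eq (mul_one n)

theorem subVec_ops_le (n : ℕ) (u v : ℕ → ZMod p) : (subVec n u v).ops ≤ n :=
  (tabulate_ops_le _ n 1 _ fun _ _ => le_rfl).trans_eq (mul_one n)

/-- Passing from l to l + 1 doubles the cost and adds 2^l n for the twiddle factors and 2·2^l n for
the butterflies. The bound leaves room for 4·2^l n. -/
theorem fft_ops_le (n l g : ℕ) (A : ℕ → ℕ → ZMod p) :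
    (fft n l g A).ops ≤ 2 * l * (2 ^ l * n) := by
  induction l generalizing g A with
  | zero => simp [fft]
  | succ l ih =>
    rw [fft]
    simp only [Counted.bind_ops]
    have h3 : ∀ Q : ℕ → ℕ → ZMod p, (tabulate (fun _ => (FieldOps.zero : ZMod p)) (2 ^ l)
        fun j => mulXPow n (g * j) (Q j)).ops ≤ 2 ^ l * n :=
      fun Q => tabulate_ops_le _ _ _ _ fun _ _ => mulXPow_ops_le _ _ _
    have h4 : ∀ P T : ℕ → ℕ → ZMod p, (tabulate (fun _ => (FieldOps.zero : ZMod p)) (2 ^ (l + 1))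
        fun i => if i < 2 ^ l then addVec n (P i) (T i)
          else subVec n (P (i - 2 ^ l)) (T (i - 2 ^ l))).ops ≤ 2 ^ (l + 1) * n := by
      refine fun P T => tabulate_ops_le _ _ _ _ fun i _ => ?_
      split_ifs
      · exact addVec_ops_le _ _ _
      · exact subVec_ops_le _ _ _
    refine (add_le_add (ih _ _) (add_le_add (ih _ _) (add_le_add (h3 _) (h4 _ _)))).trans ?_
    rw [pow_succ]
    nlinarith [Nat.zero_le (2 ^ l * n)]

theorem naiveCoeff_ops_le (n : ℕ) (u v : ℕ → ZMod p) (i j : ℕ) :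
    (naiveCoeff n u v i j).ops ≤ 2 * j := by
  induction j with
  | zero => simp [naiveCoeff]
  | succ j ih =>
    rw [naiveCoeff, Counted.bind_ops]
    split_ifs <;> simp only [Counted.bind_ops, FieldOps.mul_ops, FieldOps.add_ops,
      FieldOps.sub_ops] <;> omega

theorem twoPow_ops (l : ℕ) : (twoPow l : Counted (ZMod p)).ops = l := by
  induction l with
  | zero => rfl
  | succ l ih => rw [twoPow, Counted.bind_ops, ih, FieldOps.add_ops]

/-- The recurrence for the cost per coefficient: the recursive products have total length 2·2^k,
hence the factor 2. Halving k divides 2k³ by 8, which leaves room for the rounding k/2 + 1 and the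
linear overhead. The 8 covers the quadratic base case, 2·2^k ≤ 8 for k < 3. -/
theorem negMul_recursion_le {k : ℕ} (hk : 3 ≤ k) :
    2 * (10 * (k / 2 + 1) ^ 3 + 8) + 17 * k ≤ 10 * k ^ 3 + 8 := by
  rcases Nat.even_or_odd' k with ⟨q, rfl | rfl⟩
  · rw [Nat.mul_div_cancel_left q two_pos]
    obtain ⟨t, rfl⟩ : ∃ t, q = t + 2 := ⟨q - 2, by omega⟩
    ring_nf
    nlinarith [Nat.zero_le t, Nat.zero_le (t ^ 2), Nat.zero_le (t ^ 3)]
  · rw [show (2 * q + 1) / 2 = q by omega]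
    obtain ⟨t, rfl⟩ : ∃ t, q = t + 1 := ⟨q - 1, by omega⟩
    ring_nf
    nlinarith [Nat.zero_le t, Nat.zero_le (t ^ 2), Nat.zero_le (t ^ 3)]

/-- The Schönhage–Strassen routine is quasi-linear. -/
theorem negMul_ops_le (k : ℕ) (u v : ℕ → ZMod p) :
    (negMul k u v).ops ≤ 2 ^ k * (10 * k ^ 3 + 8) := by
  induction k using Nat.strong_induction_on generalizing u v with
  | _ k ih =>
    by_cases hk : k < 3
    · rw [negMul, dif_pos hk]
      refine (tabulate_ops_le _ _ (2 * 2 ^ k) _ fun i _ => naiveCoeff_ops_le _ _ _ _ _).trans ?_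
      have : 2 ^ k ≤ 2 ^ 2 := Nat.pow_le_pow_right two_pos (by omega)
      exact Nat.mul_le_mul_left _ (by omega)
    obtain ⟨U, V, U', V', W', W, Z, c, c', hU, hV, hU', hV', hW', hW, hc, hc', hZ, hval⟩ :=
      negMul_eq_of_three_le hk u v
    have hops := congrArg Counted.ops hval
    dsimp only at hops
    rw [hops]
    set l := k - k / 2 with hl
    set m := 2 ^ (k / 2) with hm
    have hlm : 2 ^ l * (2 * m) = 2 * 2 ^ k := by
      rw [mul_left_comm, hm, ← pow_add]; congr 2; omega
    have hn2 : 2 ^ (k / 2 + 1) = 2 * m := by rw [pow_succ, mul_comm]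
    have bU : U.ops ≤ 2 * 2 ^ k := by
      rw [hU, ← hlm]; exact tabulate_ops_le _ _ _ _ fun _ _ => mulXPow_ops_le _ _ _
    have bV : V.ops ≤ 2 * 2 ^ k := by
      rw [hV, ← hlm]; exact tabulate_ops_le _ _ _ _ fun _ _ => mulXPow_ops_le _ _ _
    have bU' : U'.ops ≤ 2 * l * (2 * 2 ^ k) := by rw [hU', ← hlm]; exact fft_ops_le _ _ _ _
    have bV' : V'.ops ≤ 2 * l * (2 * 2 ^ k) := by rw [hV', ← hlm]; exact fft_ops_le _ _ _ _
    have bW : W.ops ≤ 2 * l * (2 * 2 ^ k) := by rw [hW, ← hlm]; exact fft_ops_le _ _ _ _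
    have bW' : W'.ops ≤ 2 ^ k * (2 * (10 * (k / 2 + 1) ^ 3 + 8)) := by
      rw [hW']
      refine (tabulate_ops_le _ _ _ _ fun j _ => ih (k / 2 + 1) (by omega) _ _).trans_eq ?_
      rw [← mul_assoc, hn2, hlm]
      ring
    have bc : c.ops = l := by rw [hc, twoPow_ops]
    have bc' : c'.ops = 1 := by rw [hc', FieldOps.div_ops]
    have bZ : Z.ops ≤ 2 * (2 * 2 ^ k) := by
      rw [hZ]
      refine (tabulate_ops_le _ _ _ _ fun _ _ => scaleShift_ops_le _ _ _ _).trans_eq ?_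
      rw [mul_left_comm, hlm]
    have bF : ∀ f : ℕ → Counted (ZMod p), (∀ i, (f i).ops ≤ 1) →
        (tabulate FieldOps.zero (2 ^ k) f).ops ≤ 2 ^ k := fun f hf =>
      (tabulate_ops_le _ _ 1 _ fun i _ => hf i).trans_eq (mul_one _)
    have bF' := bF (fun q =>
      if q / m = 0 then FieldOps.sub (Z.val 0 (q % m)) (Z.val (2 ^ l - 1) (m + q % m))
      else FieldOps.add (Z.val (q / m) (q % m)) (Z.val (q / m - 1) (m + q % m)))
      (fun i => by split_ifs <;> simp)
    -- In units of 2^k the overhead is at most 6(k + 1) for three transforms, 4 for the weights, 4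
    -- for the rescaling, 1 for the reassembly and 1 for the inverse of 2^l: below 17k since k ≥ 3.
    have hrec := Nat.mul_le_mul_left (2 ^ k) (negMul_recursion_le (not_lt.1 hk))
    rw [mul_add] at hrec
    have h2l : 2 * l ≤ k + 1 := by omega
    have hk1 : k + 1 ≤ 2 ^ k := Nat.lt_two_pow_self
    have h3 : 2 * l * (2 * 2 ^ k) ≤ (k + 1) * (2 * 2 ^ k) := Nat.mul_le_mul_right _ h2l
    have h4 : 3 * 2 ^ k ≤ k * 2 ^ k := Nat.mul_le_mul_right _ (not_lt.1 hk)
    have h5 : (k + 1) * (2 * 2 ^ k) = 2 * (k * 2 ^ k) + 2 * 2 ^ k := by ring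
    have h6 : 2 ^ k * (17 * k) = 17 * (k * 2 ^ k) := by ring
    rw [h5] at h3
    rw [h6] at hrec
    omega

/-- Rounding the length up to a power of two at most doubles it. -/
theorem biMul_ops_le (X₁ Y₁ X₂ Y₂ : ℕ) (u v : ℕ → ℕ → ZMod p) {S : ℕ}
    (hS : (X₁ + X₂ + 1) * (Y₁ + Y₂ + 1) ≤ S) :
    (biMul X₁ Y₁ X₂ Y₂ u v).ops ≤ 2 * S * (10 * Nat.clog 2 S ^ 3 + 8) := by
  rw [biMul]
  simp only [Counted.bind_ops, Counted.pure_ops, add_zero]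
  refine (negMul_ops_le _ _ _).trans ?_
  have hclog := Nat.clog_mono_right 2 hS
  refine Nat.mul_le_mul ?_ (by gcongr)
  set s := (X₁ + X₂ + 1) * (Y₁ + Y₂ + 1) with hs
  have hpos : 0 < s := by positivity
  rcases Nat.lt_or_ge 1 s with h1 | h1
  · have h2 := Nat.pow_pred_clog_lt_self (b := 2) one_lt_two h1
    have h3 : 0 < Nat.clog 2 s := Nat.clog_pos one_lt_two h1
    calc 2 ^ Nat.clog 2 s = 2 ^ (Nat.clog 2 s).pred * 2 := by
          rw [← pow_succ, Nat.pred_eq_sub_one, Nat.sub_add_cancel h3]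
      _ ≤ s * 2 := Nat.mul_le_mul_right _ h2.le
      _ ≤ 2 * S := by omega
  · rw [Nat.clog_of_right_le_one h1]
    omega

/-- Each halving of n costs at most two products, and all of them fit in the size of the final
power. -/
theorem biPow_ops_le (X Y : ℕ) (b : ℕ → ℕ → ZMod p) (n : ℕ) {S : ℕ}
    (hS : (n * X + 1) * (n * Y + 1) ≤ S) :
    (biPow X Y b n).ops ≤ Nat.log 2 n * (2 * (2 * S * (10 * Nat.clog 2 S ^ 3 + 8))) := by
  induction n using Nat.strong_induction_on with
  | _ n ih =>
    rw [biPow]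
    by_cases h0 : n = 0
    · simp [h0]
    by_cases h1 : n = 1
    · simp [h1]
    rw [dif_neg h0, if_neg h1]
    simp only [Counted.bind_ops]
    have hle : n / 2 + n / 2 ≤ n := by omega
    have hq := ih (n / 2) (by omega) (le_trans (by gcongr <;> omega) hS)
    have hs := biMul_ops_le (n / 2 * X) (n / 2 * Y) (n / 2 * X) (n / 2 * Y)
      (biPow X Y b (n / 2)).val (biPow X Y b (n / 2)).val
      (le_trans (by rw [← add_mul, ← add_mul]; gcongr) hS)
    have hlog : Nat.log 2 n = Nat.log 2 (n / 2) + 1 := Nat.log_of_one_lt_of_le one_lt_two (by omega)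
    rw [hlog, add_mul, one_mul]
    split_ifs with hmod
    · rw [Counted.pure_ops]
      omega
    · have ht := fun s => biMul_ops_le (2 * (n / 2) * X) (2 * (n / 2) * Y) X Y s b
        (le_trans (by rw [← Nat.succ_mul, ← Nat.succ_mul]; gcongr <;> omega) hS)
      have := ht (biMul (n / 2 * X) (n / 2 * Y) (n / 2 * X) (n / 2 * Y)
        (biPow X Y b (n / 2)).val (biPow X Y b (n / 2)).val).val
      omega

/-! ### Total cost and absolute constants -/

theorem intTable_ops (n : ℕ) : (intTable n : Counted (ℕ → ZMod p)).ops = n := by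
  induction n with
  | zero => rfl
  | succ n ih =>
    rw [intTable]
    simp only [Counted.bind_ops, ih, FieldOps.add_ops, Counted.pure_ops]

theorem dot_ops (u v : ℕ → ZMod p) (n : ℕ) : (dot u v n).ops = 2 * n := by
  induction n with
  | zero => rfl
  | succ n ih =>
    rw [dot]
    simp only [Counted.bind_ops, ih, FieldOps.mul_ops, FieldOps.add_ops]
    ring

theorem matVec_ops (n : ℕ) (A : ℕ → ℕ → ZMod p) (v : ℕ → ZMod p) :
    (matVec n A v).ops = n * (2 * n) := by
  simp [matVec, tabulate_ops, dot_ops]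

theorem applyDigits_ops (R : LinRep (ZMod p)) (digits : List ℕ) (v : ℕ → ZMod p) :
    (applyDigits R digits v).ops = digits.length * (R.size * (2 * R.size)) := by
  induction digits generalizing v with
  | nil => simp [applyDigits]
  | cons r rs ih =>
    rw [applyDigits, Counted.bind_ops, ih, matVec_ops, List.length_cons]
    ring

theorem evalLinRep_ops (R : LinRep (ZMod p)) (N : ℕ) :
    (evalLinRep p R N).ops =
      3 * R.size + (Nat.digits p N).length * (R.size * (2 * R.size)) := by
  rw [evalLinRep]
  simp only [Counted.bind_ops, applyDigits_ops, dot_ops, tabulate_ops, FieldOps.div_ops,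
    sum_const, card_range, smul_eq_mul, mul_one]
  ring

theorem length_digits_le {q : ℕ} (hq : 2 ≤ q) (N : ℕ) :
    (Nat.digits q N).length ≤ Nat.log 2 N + 1 := by
  rcases Nat.eq_zero_or_pos N with rfl | hN
  · simp
  · rw [Nat.length_digits q N (by omega) hN.ne']
    exact Nat.succ_le_succ (Nat.log_anti_left one_lt_two hq)

/-- The number of operations, in natural numbers. -/
theorem nthCoeffViaDiagonals_ops_le {E : MvPolynomial (Fin 2) (ZMod p)} {h d : ℕ} (hh : 1 ≤ h)
    (hx : E.degreeOf 0 ≤ h) (hy : E.degreeOf 1 ≤ d) (N : ℕ) {M : ℕ}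
    (hM : M = p ^ 2 * h * (d + h)) :
    (nthCoeffViaDiagonals p h d (fun i j => E.coeff (expo i j)) N).ops ≤
      15 * M + Nat.clog 2 M * (4 * M * (10 * Nat.clog 2 M ^ 3 + 8)) +
        32 * (h ^ 2 * (d + h) ^ 2) * (Nat.log 2 N + 1) := by
  have hp2 := (Fact.out : p.Prime).two_le
  obtain ⟨b, -, hpre⟩ := precompute_eq hx hy
  have hdx := diagDegX_le hx hy
  have hdy := diagDegY_le hx hy
  rw [nthCoeffViaDiagonals, Counted.bind_ops, evalLinRep_ops, hpre, intTable_ops]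
  dsimp only
  generalize diagDegX E = dx at *
  generalize diagDegY E = dy at *
  set S := (dx + 1) * (dy + 1) with hS
  have hSle : S ≤ 4 * (h * (d + h)) := by
    calc S ≤ (2 * h) * (2 * (d + h)) := Nat.mul_le_mul (by omega) (by omega)
      _ = 4 * (h * (d + h)) := by ring
  have hpow : (( p - 1) * dx + 1) * ((p - 1) * dy + 1) ≤ M := by
    -- The + 1 in the number of coefficients is absorbed by replacing p - 1 with p, because h ≥ 1.
    have aux : ∀ x y : ℕ, x ≤ y → 1 ≤ y → (p - 1) * x + 1 ≤ p * y := by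
      intro x y hxy hy1
      obtain ⟨q, rfl⟩ : ∃ q, p = q + 1 := ⟨p - 1, by omega⟩
      rw [Nat.add_sub_cancel, add_mul, one_mul]
      exact add_le_add (Nat.mul_le_mul_left q hxy) hy1
    calc ((p - 1) * dx + 1) * ((p - 1) * dy + 1) ≤ (p * h) * (p * (d + h)) :=
          Nat.mul_le_mul (aux _ _ hdx hh) (aux _ _ hdy (by omega))
      _ = M := by rw [hM]; ring
  have hB := biPow_ops_le dx dy b (p - 1) hpow
  have hhM : h * (d + h) ≤ M := by
    rw [hM, mul_assoc]
    exact Nat.le_mul_of_pos_left _ (by positivity)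
  have hpM : p - 1 ≤ M := by
    have h1 : 1 ≤ h * (d + h) := Nat.mul_pos hh (by omega)
    calc p - 1 ≤ p := Nat.sub_le _ _
      _ ≤ p ^ 2 := Nat.le_self_pow two_ne_zero p
      _ ≤ p ^ 2 * (h * (d + h)) := Nat.le_mul_of_pos_right _ h1
      _ = M := by rw [hM, mul_assoc]
  have hlog : Nat.log 2 (p - 1) ≤ Nat.clog 2 M :=
    (Nat.log_mono_right hpM).trans (Nat.log_le_clog 2 M)
  have hB' := hB.trans (Nat.mul_le_mul_right _ hlog)
  -- Together with 3S ≤ 12h(d + h), from the divisions and the final dot product, this gives the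
  -- term 15M.
  have h1 : d + (h + 1) * (d + 1) ≤ 3 * (h * (d + h)) := by nlinarith
  have h2 : (Nat.digits p N).length * (S * (2 * S)) ≤
      32 * (h ^ 2 * (d + h) ^ 2) * (Nat.log 2 N + 1) := by
    rw [mul_comm]
    refine Nat.mul_le_mul ?_ (length_digits_le hp2 N)
    calc S * (2 * S) ≤ 4 * (h * (d + h)) * (2 * (4 * (h * (d + h)))) := by gcongr
      _ = 32 * (h ^ 2 * (d + h) ^ 2) := by ring
  have h3 : Nat.clog 2 M * (2 * (2 * M * (10 * Nat.clog 2 M ^ 3 + 8))) =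
      Nat.clog 2 M * (4 * M * (10 * Nat.clog 2 M ^ 3 + 8)) := by ring
  omega

theorem clog_two_le_log {M : ℕ} (hM : 8 ≤ M) : (Nat.clog 2 M : ℝ) ≤ 3 * Real.log M := by
  have h2 := Nat.pow_pred_clog_lt_self (b := 2) one_lt_two (by omega : 1 < M)
  have hpos : 0 < Nat.clog 2 M := Nat.clog_pos one_lt_two (by omega)
  have hl2 := Real.log_two_gt_d9
  have hlM : Real.log 2 ≤ Real.log M / 3 := by
    have : Real.log ((2 : ℝ) ^ 3) ≤ Real.log M :=
      Real.log_le_log (by norm_num) (by norm_num; exact_mod_cast hM)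
    rw [Real.log_pow] at this
    push_cast at this
    linarith
  have h3 : ((Nat.clog 2 M : ℝ) - 1) * Real.log 2 ≤ Real.log M := by
    have h4 : Real.log ((2 : ℝ) ^ (Nat.clog 2 M).pred) ≤ Real.log M :=
      Real.log_le_log (by positivity) (by exact_mod_cast h2.le)
    rw [Real.log_pow, Nat.pred_eq_sub_one, Nat.cast_sub hpos, Nat.cast_one] at h4
    exact h4
  nlinarith

theorem log_two_add_one_le_log (N : ℕ) :
    ((Nat.log 2 N + 1 : ℕ) : ℝ) ≤ 3 * Real.log (max (N : ℝ) 2) := by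
  have hl2 := Real.log_two_gt_d9
  have h1 : Real.log 2 ≤ Real.log (max (N : ℝ) 2) :=
    Real.log_le_log (by norm_num) (le_max_right _ _)
  have h2 : (Nat.log 2 N : ℝ) * Real.log 2 ≤ Real.log (max (N : ℝ) 2) := by
    rcases Nat.eq_zero_or_pos N with rfl | hN
    · rw [Nat.log_zero_right, Nat.cast_zero, zero_mul]
      exact Real.log_nonneg (le_max_of_le_right one_le_two)
    · rw [← Real.log_pow]
      refine Real.log_le_log (by positivity) (le_max_of_le_left ?_)
      exact_mod_cast Nat.pow_log_le_self 2 hN.ne'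
  push_cast
  nlinarith

/-- The number of operations, with absolute constants. -/
theorem nthCoeffViaDiagonals_ops_le_log {E : MvPolynomial (Fin 2) (ZMod p)} {h d : ℕ} (hh : 1 ≤ h)
    (hd : 1 ≤ d) (hx : E.degreeOf 0 ≤ h) (hy : E.degreeOf 1 ≤ d) (N : ℕ) :
    ((nthCoeffViaDiagonals p h d (fun i j => E.coeff (expo i j)) N).ops : ℝ) ≤
      10000 * ((h : ℝ) ^ 2 * ((d : ℝ) + h) ^ 2 * Real.log (max (N : ℝ) 2)) +
        10000 * ((p : ℝ) ^ 2 * h * ((d : ℝ) + h) *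
          Real.log ((p : ℝ) ^ 2 * h * ((d : ℝ) + h)) ^ 4) := by
  have hops := nthCoeffViaDiagonals_ops_le hh hx hy N rfl
  have hcast : ((p ^ 2 * h * (d + h) : ℕ) : ℝ) = (p : ℝ) ^ 2 * h * ((d : ℝ) + h) := by push_cast; rfl
  rw [← hcast]
  -- With p ≥ 2 and h, d ≥ 1, M is bounded below, so log M absorbs the rounding of the binary
  -- logarithm.
  have hM : 8 ≤ p ^ 2 * h * (d + h) := by
    have hp2 := (Fact.out : p.Prime).two_le
    calc 8 = 2 ^ 2 * 1 * (1 + 1) := by norm_num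
      _ ≤ p ^ 2 * h * (d + h) := by gcongr
  generalize p ^ 2 * h * (d + h) = M at *
  have hK := clog_two_le_log hM
  have hK1 : 1 ≤ Nat.clog 2 M := Nat.clog_pos one_lt_two (by omega)
  have hN := log_two_add_one_le_log N
  set K := Nat.clog 2 M with hKdef
  -- 87 = 15 + 40 + 32, every lower power of K being bounded by K^4.
  have hmain : 15 * M + K * (4 * M * (10 * K ^ 3 + 8)) ≤ 87 * (M * K ^ 4) := by
    have e1 : 1 ≤ K ^ 4 := Nat.one_le_pow _ _ hK1
    have e2 : K ≤ K ^ 4 := Nat.le_self_pow (by norm_num) K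
    have e3 : M * 1 ≤ M * K ^ 4 := Nat.mul_le_mul_left M e1
    have e4 : M * K ≤ M * K ^ 4 := Nat.mul_le_mul_left M e2
    have e5 : K * (4 * M * (10 * K ^ 3 + 8)) = 40 * (M * K ^ 4) + 32 * (M * K) := by ring
    omega
  have h1 : ((nthCoeffViaDiagonals p h d (fun i j => E.coeff (expo i j)) N).ops : ℝ) ≤
      87 * (M * (K : ℝ) ^ 4) +
        32 * ((h : ℝ) ^ 2 * ((d : ℝ) + h) ^ 2) * ((Nat.log 2 N + 1 : ℕ) : ℝ) := by
    have := hops.trans (Nat.add_le_add_right hmain _)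
    exact_mod_cast this
  have h2 : (K : ℝ) ^ 4 ≤ 81 * Real.log M ^ 4 := by
    calc (K : ℝ) ^ 4 ≤ (3 * Real.log M) ^ 4 := by gcongr
      _ = 81 * Real.log M ^ 4 := by ring
  have h3 : (M : ℝ) * (K : ℝ) ^ 4 ≤ M * (81 * Real.log M ^ 4) := by gcongr
  have h4 : 32 * ((h : ℝ) ^ 2 * ((d : ℝ) + h) ^ 2) * ((Nat.log 2 N + 1 : ℕ) : ℝ) ≤
      32 * ((h : ℝ) ^ 2 * ((d : ℝ) + h) ^ 2) * (3 * Real.log (max (N : ℝ) 2)) := by gcongr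
  have h5 : 0 ≤ (h : ℝ) ^ 2 * ((d : ℝ) + h) ^ 2 * Real.log (max (N : ℝ) 2) :=
    mul_nonneg (by positivity) (Real.log_nonneg (le_max_of_le_right one_le_two))
  have h6 : 0 ≤ (M : ℝ) * Real.log M ^ 4 := by positivity
  -- The constants obtained are 87·81 = 7047 and 32·3 = 96, both below 10000.
  nlinarith

end Algo

/-! ### The main theorem -/

/-- E_y(0,0) is the coefficient of y in E. The bound d ≥ 1 keeps log(p²h(d + h)) away from zero in
the cost estimate. -/
theorem one_le_degree_of_pderiv {F : Type} [Field F] {E : MvPolynomial (Fin 2) F} {d : ℕ}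
    (hy : E.degreeOf 1 ≤ d) (hEy : MvPolynomial.constantCoeff (MvPolynomial.pderiv 1 E) ≠ 0) :
    1 ≤ d := by
  rw [← constantCoeff_diagDen, MvPolynomial.constantCoeff_eq, ← expo_zero_zero, coeff_diagDen,
    if_pos (by omega)] at hEy
  exact (degrees_of_coeff_ne_zero le_rfl hy hEy).2

/-- `O` and `Õ` are uniform: the constants `c` and `κ` depend on nothing. The logarithm of `N` is
written `log (max N 2)`, which is `log N` for `N ≥ 2`, so that `N = 0` and `N = 1` are covered. -/
theorem theorem2 :
    ∃ (c : ℝ) (κ : ℕ), ∀ (p : ℕ) [Fact p.Prime] (h d : ℕ) (E : MvPolynomial (Fin 2) (ZMod p)),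
      1 ≤ h → E.degreeOf 0 ≤ h → E.degreeOf 1 ≤ d →
      MvPolynomial.constantCoeff E = 0 →
      MvPolynomial.constantCoeff (MvPolynomial.pderiv 1 E) ≠ 0 →
      ∃ f : PowerSeries (ZMod p),
        -- `f` is the unique root of `E` with `f(0) = 0`
        (IsRootAtZero E f ∧ ∀ g : PowerSeries (ZMod p), IsRootAtZero E g → g = f) ∧
        -- `f` is the diagonal of `a / b`, where `b(0,0) ≠ 0`
        (MvPolynomial.constantCoeff (diagDen E) ≠ 0 ∧
          f = diagonal ((diagNum E : MvPowerSeries (Fin 2) (ZMod p)) *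
            (diagDen E : MvPowerSeries (Fin 2) (ZMod p))⁻¹)) ∧
        -- `S_r (v / b) = S_r (v b ^ (p - 1)) / b`
        (∀ r < p, ∀ v : MvPolynomial (Fin 2) (ZMod p),
          bisection p r ((v : MvPowerSeries (Fin 2) (ZMod p)) *
              (diagDen E : MvPowerSeries (Fin 2) (ZMod p))⁻¹) =
            bisection p r ((v * diagDen E ^ (p - 1) : MvPolynomial (Fin 2) (ZMod p)) :
                MvPowerSeries (Fin 2) (ZMod p)) *
              (diagDen E : MvPowerSeries (Fin 2) (ZMod p))⁻¹) ∧
        -- the linear representation of size `(1 + d_x) (1 + d_y)`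
        (diagDegX E ≤ h ∧ diagDegY E ≤ d + h ∧ ∀ N : ℕ,
          PowerSeries.coeff N f =
            evalVector (ZMod p) (diagDegX E) (diagDegY E) ⬝ᵥ
              ((((Nat.digits p N).reverse.map
                  (sectionMatrix p (diagDen E) (diagDegX E) (diagDegY E))).prod).mulVec
                (coordVector (diagNum E) (diagDegX E) (diagDegY E))) /
              MvPolynomial.constantCoeff (diagDen E)) ∧
        -- the algorithm computes `f_N` within the announced number of operations
        (∀ N : ℕ,
          (Algo.nthCoeffViaDiagonals p h d (fun i j => E.coeff (expo i j)) N).val =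
              PowerSeries.coeff N f ∧
          ((Algo.nthCoeffViaDiagonals p h d (fun i j => E.coeff (expo i j)) N).ops : ℝ) ≤
            c * ((h : ℝ) ^ 2 * ((d : ℝ) + h) ^ 2 * Real.log (max (N : ℝ) 2)) +
            c * ((p : ℝ) ^ 2 * h * ((d : ℝ) + h) *
              Real.log ((p : ℝ) ^ 2 * h * ((d : ℝ) + h)) ^ κ)) := by
  -- The exponent is 3 from the multiplication plus 1 from the number of squarings, at most log p up
  -- to a constant.
  refine ⟨10000, 4, ?_⟩
  intro p _ h d E hh hx hy hE hEy
  obtain ⟨f, hf, huniq⟩ := existsUnique_isRootAtZero hE hEy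
  have hb0 : MvPolynomial.constantCoeff (diagDen E) ≠ 0 := by rwa [constantCoeff_diagDen]
  have hdiag := diagonal_diagNum_mul_inv_diagDen hE hEy hf
  have hlin : ∀ N : ℕ, PowerSeries.coeff N f =
      evalVector (ZMod p) (diagDegX E) (diagDegY E) ⬝ᵥ
        ((((Nat.digits p N).reverse.map
            (sectionMatrix p (diagDen E) (diagDegX E) (diagDegY E))).prod).mulVec
          (coordVector (diagNum E) (diagDegX E) (diagDegY E))) /
        MvPolynomial.constantCoeff (diagDen E) := by
    intro N
    rw [← coeff_mul_inv_eq_linearRepresentation (biDegreeLE_diagDen E) hb0 N _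
      (biDegreeLE_diagNum E)]
    conv_lhs => rw [← hdiag, diagonal, PowerSeries.coeff_mk]
  refine ⟨f, ⟨hf, huniq⟩, ⟨hb0, hdiag.symm⟩, fun r hr v => bisection_mul_inv hr v _ hb0,
    ⟨diagDegX_le hx hy, diagDegY_le hx hy, hlin⟩, fun N => ⟨?_, ?_⟩⟩
  · rw [hlin N, Algo.nthCoeffViaDiagonals_val hx hy]
  · exact Algo.nthCoeffViaDiagonals_ops_le_log hh (one_le_degree_of_pderiv hy hEy) hx hy N
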